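/- All rings are commutative with identity; *quasilocal* means having a unique maximal ideal, and a *local Noetherian* ring is a quasilocal Noetherian ring. An ideal $I$ of a ring $R$ is *stable* if it is projective as a module over its endomorphism ring $\operatorname{End}_R(I)$; a domain is *stable* if all of its nonzero ideals are stable. A ring $R$ has *finite normalization* if its integral closure $\overline{R}$ in its total ring of quotients is a finite $R$-module. A *bad stable domain* is a quasilocal stable domain of Krull dimension $1$ that does not have finite normalization. For a domain $R$, let $\widetilde{R}=\varprojlim R/rR$, where $r$ ranges over the nonzero elements of $R$ ordered by divisibility (the completion of $R$ in the ideal topology); for a quasilocal ring $R$ with maximal ideal $\mathfrak m$, let $\widehat{R}=\varprojlim R/\mathfrak m^n$ (the $\mathfrak m$-adic completion). (1) Let $R$ be a quasilocal domain of Krull dimension $1$. Then $R$ is a bad stable domain if and only if there is a nonzero prime ideal $P$ of $\widetilde{R}$ such that $P^2=0$ and $\widetilde{R}/P$ is a DVR (discrete valuation ring). (2) Let $R$ be a local Noetherian domain (of any Krull dimension). Then $R$ is a bad stable domain if and only if there is a nonzero prime ideal $P$ of $\widehat{R}$ such that $P^2=0$ and $\widehat{R}/P$ is a DVR. -/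

import Mathlib

universe u

/-- An ideal `I` of a ring `R` is stable if it is projective as a module over its ring of
`R`-module endomorphisms. -/
def Ideal.IsStable {R : Type u} [CommRing R] (I : Ideal R) : Prop :=
  Module.Projective (Module.End R I) I

/-- The property (used for domains `R`) that every nonzero ideal is stable. -/
def IsStableRing (R : Type u) [CommRing R] : Prop :=
  ∀ I : Ideal R, I ≠ ⊥ → I.IsStable

/-- `R` has finite normalization if its integral closure in its total ring of quotients is a
finite `R`-module. -/
def HasFiniteNormalization (R : Type u) [CommRing R] : Prop :=
  Module.Finite R (integralClosure R (FractionRing R))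

/-- A bad stable domain: a quasilocal stable domain of Krull dimension `1` that does not have
finite normalization. (`IsLocalRing` does not include the Noetherian property.) -/
structure IsBadStableDomain (R : Type u) [CommRing R] : Prop where
  isDomain : IsDomain R
  isLocalRing : IsLocalRing R
  krullDim_eq_one : ringKrullDim R = 1
  stable : IsStableRing R
  not_finite : ¬ HasFiniteNormalization R

/-- The completion of a ring `R` in the ideal topology: the inverse limit of the rings `R ⧸ rR`
over the nonzero `r : R` ordered by divisibility, realized as the ring of compatible families
in the product. (For a domain, any `R ⧸ rR` and `R ⧸ sR` are both images of `R ⧸ rsR`.) -/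
def idealTopologyCompletion (R : Type u) [CommRing R] :
    Subring (∀ r : {r : R // r ≠ 0}, R ⧸ Ideal.span {(r : R)}) where
  carrier := {x | ∀ (r s : {r : R // r ≠ 0}) (h : (r : R) ∣ (s : R)),
    Ideal.Quotient.factor (Ideal.span_singleton_le_span_singleton.mpr h) (x s) = x r}
  mul_mem' := by
    intro a b ha hb r s h
    simp only [Pi.mul_apply, map_mul, ha r s h, hb r s h]
  one_mem' := by
    intro r s h
    simp only [Pi.one_apply, map_one]
  add_mem' := by
    intro a b ha hb r s h
    simp only [Pi.add_apply, map_add, ha r s h, hb r s h]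
  zero_mem' := by
    intro r s h
    simp only [Pi.zero_apply, map_zero]
  neg_mem' := by
    intro a ha r s h
    simp only [Pi.neg_apply, map_neg, ha r s h]

/-- `T` has a nonzero prime ideal `P` with `P ^ 2 = 0` such that `T ⧸ P` is a discrete valuation
ring. -/
def HasSquareZeroPrimeWithDVRQuotient (T : Type u) [CommRing T] : Prop :=
  ∃ (P : Ideal T) (_ : P.IsPrime), P ≠ ⊥ ∧ P ^ 2 = ⊥ ∧ IsDiscreteValuationRing (T ⧸ P)

/-! Over a local domain whose nonzero ideals are all stable, every nonzero ideal `I` satisfies `I² =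
zI` for some `z ∈ I`; conversely `I² = zI` makes `I` free of rank one over its endomorphism ring. So
stability is handled as an elementwise condition, `Ideal.HasPrincipalSquare`.

Bad stable implies the prime exists. Let `S` be the normalization of `R`. Principal squares make `S`
Bézout and quadratic: each `R + Rs + Rt` is a ring. If `S` is not finite over `R`, then it is local
with the residue field of `R` (`IsQuadraticAlgebra.exists_sub_mem_jacobson`), hence a valuation
ring. Taking `m² = πm`, either `S = R + πS` or `R` has a nonzero conductor in `S`, and the latter
forces finiteness. Hence `π` is a uniformizer of `S` and `R` is dense in `S` (`exists_uniformizer`).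
Let `P` be the kernel from the `π`-adic completion `T` of `R` to that of `S`. The quotient `T/P` is
a DVR, `P ≠ 0` because `S ≠ R`, and `P² = 0` because `S` is quadratic.

The converse. Let `V = T/P`, and choose `x ∈ I` of least value in `V`. For `y, z ∈ I` write `y - xt,
z - xt' ∈ P`; the product of these is zero, so `yz` lies in `(x², xy, xz)T ∩ R = (x², xy, xz)`,
whence `I² = xI`. If the normalization were finite, divisibility in `V` between elements of `R`
would descend to `R`; then every element of `P` would be divisible by all `π^n`, giving `P = 0`.

Both completions enter only through `IsPrincipalAdicCompletion`. In the Noetherian case dimension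
one is itself deduced from `P² = 0`. -/

/-! ### Stable ideals and principal squares -/

/-- `I ^ 2 = z I` for some `z ∈ I`. -/
def Ideal.HasPrincipalSquare {R : Type*} [CommRing R] (I : Ideal R) : Prop :=
  ∃ z ∈ I, ∀ a ∈ I, ∀ b ∈ I, ∃ c ∈ I, a * b = z * c

theorem Ideal.HasPrincipalSquare.exists_ne_zero {R : Type*} [CommRing R] [IsDomain R]
    {I : Ideal R} (hI : I ≠ ⊥) (h : I.HasPrincipalSquare) :
    ∃ z ∈ I, z ≠ 0 ∧ ∀ a ∈ I, ∀ b ∈ I, ∃ c ∈ I, a * b = z * c := by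
  obtain ⟨z, hz, h⟩ := h
  refine ⟨z, hz, ?_, h⟩
  rintro rfl
  obtain ⟨a, ha, ha0⟩ := Submodule.exists_mem_ne_zero_of_ne_bot hI
  obtain ⟨c, -, hc⟩ := h a ha a ha
  simp_all

/-- Both sides equal `φ(ab)`. Over a domain this says that `φ` is multiplication by the fraction
`φ(a)/a`. -/
theorem Module.End.ideal_apply_mul {R : Type*} [CommRing R] {I : Ideal R}
    (φ : Module.End R I) (a b : I) : (φ a : R) * b = φ b * a := by
  have h1 : φ ((a : R) • b) = φ ((b : R) • a) := by
    congr 1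
    ext
    simp [mul_comm]
  rw [map_smul, map_smul] at h1
  have h2 := congrArg Subtype.val h1
  simp only [SetLike.val_smul, smul_eq_mul] at h2
  rw [mul_comm, ← h2, mul_comm]

/-- Evaluation at `z` is an isomorphism from `End I` to `I`: an endomorphism is determined by its
value at `z ≠ 0`, and multiplication by `y/z` preserves `I` because `yI ⊆ zI`. -/
theorem Ideal.HasPrincipalSquare.isStable {R : Type*} [CommRing R] [IsDomain R] {I : Ideal R}
    (hI : I ≠ ⊥) (h : I.HasPrincipalSquare) : I.IsStable := by
  obtain ⟨z, hz, hz0, h⟩ := h.exists_ne_zero hI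
  let f : Module.End R I →ₗ[Module.End R I] I :=
    LinearMap.toSpanSingleton (Module.End R I) I ⟨z, hz⟩
  have hf : Function.Bijective f := by
    constructor
    · rw [injective_iff_map_eq_zero]
      intro φ hφ
      have h0 : φ ⟨z, hz⟩ = 0 := hφ
      ext b
      have h1 := φ.ideal_apply_mul ⟨z, hz⟩ b
      rw [h0] at h1
      simpa [hz0] using h1.symm
    · intro y
      choose c hcI hc using fun a : I ↦ h y y.2 a a.2
      refine ⟨{ toFun := fun a ↦ ⟨c a, hcI a⟩, map_add' := ?_, map_smul' := ?_ }, ?_⟩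
      · intro a b
        ext
        apply mul_left_cancel₀ hz0
        simp only [Submodule.coe_add, mul_add, ← hc]
      · intro r a
        ext
        apply mul_left_cancel₀ hz0
        simp only [SetLike.val_smul, smul_eq_mul, RingHom.id_apply, ← hc]
        rw [mul_left_comm, hc, mul_left_comm]
      · ext
        change c ⟨z, hz⟩ = y
        apply mul_left_cancel₀ hz0
        rw [← hc, mul_comm]
  exact Module.Projective.of_equiv (LinearEquiv.ofBijective f hf)

/-- A stable ideal has a dual basis in the fraction field. -/
theorem Ideal.IsStable.exists_dual_basis {R : Type*} [CommRing R] [IsDomain R]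
    (F : Type*) [Field F] [Algebra R F] [IsFractionRing R F] {I : Ideal R}
    (hI : I ≠ ⊥) (h : I.IsStable) :
    ∃ (n : ℕ) (x : Fin n → R) (y : Fin n → F), (∀ i, x i ∈ I) ∧
      ∑ i, y i * algebraMap R F (x i) = 1 ∧
      ∀ i, ∀ b ∈ I, ∀ c ∈ I, ∃ d ∈ I,
        algebraMap R F b * y i * algebraMap R F c = algebraMap R F d := by
  obtain ⟨a, ha, ha0⟩ := Submodule.exists_mem_ne_zero_of_ne_bot hI
  obtain ⟨s, hs⟩ := Module.projective_def.mp h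
  have ha0' : algebraMap R F a ≠ 0 := by simpa using ha0
  let T := (s ⟨a, ha⟩).support
  let e : Fin T.card ≃ T := T.equivFin.symm
  -- The coordinates of a section `s` give pairings `(b, c) ↦ s(b)_j(c)`, which must have the form
  -- `b * y_j * c`; taking `b = c = a` dictates `y_j`.
  let y : I → F := fun j ↦ algebraMap R F (s ⟨a, ha⟩ j ⟨a, ha⟩) / (algebraMap R F a ^ 2)
  have key : ∀ j : I, ∀ b c : I, algebraMap R F b * y j * algebraMap R F c =
      algebraMap R F (s b j c) := by
    intro j b c
    have h1 := (s b j).ideal_apply_mul ⟨a, ha⟩ c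
    have h2 : (a : R) * s b j ⟨a, ha⟩ = b * s ⟨a, ha⟩ j ⟨a, ha⟩ := by
      let mb : Module.End R I := LinearMap.lsmul R I b
      let ma : Module.End R I := LinearMap.lsmul R I a
      have h3 : ma • b = mb • (⟨a, ha⟩ : I) := by
        ext
        simp [ma, mb, Module.End.smul_def, mul_comm]
      have h4 := congrArg (fun t ↦ (s t j) ⟨a, ha⟩) h3
      simp only [map_smul] at h4
      exact congrArg Subtype.val h4
    have h5 : (s b j c : R) * a ^ 2 = b * s ⟨a, ha⟩ j ⟨a, ha⟩ * c := by
      rw [← h2]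
      linear_combination -a * h1
    simp only [y]
    rw [mul_div_assoc', div_mul_eq_mul_div, div_eq_iff (pow_ne_zero 2 ha0'), ← map_pow,
      ← map_mul, ← map_mul, ← map_mul, h5]
  refine ⟨T.card, fun i ↦ (e i : I), fun i ↦ y (e i), fun i ↦ (e i : I).2, ?_, ?_⟩
  · have h1 := hs ⟨a, ha⟩
    rw [Finsupp.linearCombination_apply, Finsupp.sum] at h1
    have h2 : ∑ j ∈ T, algebraMap R F (s ⟨a, ha⟩ j j) = algebraMap R F a := by
      rw [← map_sum]
      congr 1
      have h3 := congrArg Subtype.val h1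
      simpa using h3
    have h4 : ∑ j ∈ T, y j * algebraMap R F j = 1 := by
      apply mul_left_cancel₀ ha0'
      rw [Finset.mul_sum, mul_one]
      conv_rhs => rw [← h2]
      refine Finset.sum_congr rfl fun j _ ↦ ?_
      rw [← key j ⟨a, ha⟩ j, mul_assoc]
    rw [← h4, ← Finset.sum_coe_sort T]
    exact Fintype.sum_equiv e _ _ fun _ ↦ rfl
  · intro i b hb c hc
    exact ⟨_, (s ⟨b, hb⟩ (e i) ⟨c, hc⟩).2, key _ ⟨b, hb⟩ ⟨c, hc⟩⟩

/-- The ring `(I : I)` of multipliers of an ideal `I` in an extension `F` of `R`. -/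
def Ideal.multiplierSubalgebra {R : Type*} (F : Type*) [CommRing R] [CommRing F] [Algebra R F]
    (I : Ideal R) : Subalgebra R F where
  carrier := {t | ∀ c ∈ I, ∃ d ∈ I, t * algebraMap R F c = algebraMap R F d}
  mul_mem' := by
    intro s t hs ht c hc
    obtain ⟨d, hd, h1⟩ := ht c hc
    obtain ⟨e, he, h2⟩ := hs d hd
    exact ⟨e, he, by rw [mul_assoc, h1, h2]⟩
  add_mem' := by
    intro s t hs ht c hc
    obtain ⟨d, hd, h1⟩ := ht c hc
    obtain ⟨e, he, h2⟩ := hs c hc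
    exact ⟨e + d, I.add_mem he hd, by rw [add_mul, h1, h2, map_add]⟩
  algebraMap_mem' := by
    intro r c hc
    exact ⟨r * c, I.mul_mem_left r hc, by simp⟩

theorem IsFractionRing.of_subalgebra {R F : Type*} [CommRing R] [Field F] [Algebra R F]
    [IsFractionRing R F] (O : Subalgebra R F) : IsFractionRing O F := by
  refine IsFractionRing.of_field O F fun t ↦ ?_
  obtain ⟨a, b, -, h⟩ := IsFractionRing.div_surjective (A := R) t
  exact ⟨algebraMap R O a, algebraMap R O b, h.symm⟩

theorem finite_setOf_isMaximal_of_finite (R O : Type*) [CommRing R] [CommRing O] [Algebra R O]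
    [IsLocalRing R] [Module.Finite R O] : {N : Ideal O | N.IsMaximal}.Finite := by
  refine (Algebra.QuasiFinite.finite_primesOver (S := O) (IsLocalRing.maximalIdeal R)).subset ?_
  intro N (hN : N.IsMaximal)
  refine ⟨hN.isPrime, ⟨?_⟩⟩
  have := Ideal.isMaximal_comap_of_isIntegral_of_isMaximal (R := R) N
  exact (IsLocalRing.eq_maximalIdeal this).symm

/-- The dual basis exhibits `I` as an invertible module over `O = (I : I)`, with inverse spanned by
the `y i`. Invertible fractional ideals of a semilocal ring are principal, so `I = Ow`, and `I² =
wI` follows. -/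
theorem Ideal.exists_square_eq_of_dual_basis {R F : Type*} [CommRing R]
    [Field F] [Algebra R F] [IsFractionRing R F] {I : Ideal R}
    (hfin : {N : Ideal (I.multiplierSubalgebra F) | N.IsMaximal}.Finite)
    {n : ℕ} {x : Fin n → R} {y : Fin n → F} (hx : ∀ i, x i ∈ I)
    (hxy : ∑ i, y i * algebraMap R F (x i) = 1)
    (hy : ∀ i, ∀ b ∈ I, ∀ c ∈ I, ∃ d ∈ I,
        algebraMap R F b * y i * algebraMap R F c = algebraMap R F d) :
    I.HasPrincipalSquare := by
  classical
  let O := I.multiplierSubalgebra F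
  have : IsFractionRing O F := IsFractionRing.of_subalgebra O
  let J : Submodule O F := Submodule.span O (Set.range fun i ↦ algebraMap R F (x i))
  let J' : Submodule O F := Submodule.span O (Set.range y)
  have hJ : IsFractional (nonZeroDivisors O) J :=
    FractionalIdeal.isFractional_of_fg (Submodule.fg_span (Set.finite_range _))
  have hJ' : IsFractional (nonZeroDivisors O) J' :=
    FractionalIdeal.isFractional_of_fg (Submodule.fg_span (Set.finite_range _))
  have hmul : J * J' = 1 := by
    apply le_antisymm
    · rw [Submodule.span_mul_span, Submodule.span_le]
      rintro _ ⟨_, ⟨i, rfl⟩, _, ⟨j, rfl⟩, rfl⟩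
      exact Submodule.mem_one.mpr ⟨⟨_, fun c hc ↦ hy j (x i) (hx i) c hc⟩, rfl⟩
    · rw [Submodule.one_le, ← hxy]
      refine Submodule.sum_mem _ fun i _ ↦ ?_
      rw [mul_comm]
      exact Submodule.mul_mem_mul (Submodule.subset_span ⟨i, rfl⟩) (Submodule.subset_span ⟨i, rfl⟩)
  have hprinc := FractionalIdeal.isPrincipal.of_finite_maximals_of_inv (A := F) le_rfl hfin
    (⟨J, hJ⟩ : FractionalIdeal (nonZeroDivisors O) F) ⟨J', hJ'⟩
    (FractionalIdeal.coeToSubmodule_injective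
      ((FractionalIdeal.coe_mul _ _).trans (hmul.trans FractionalIdeal.coe_one.symm)))
  obtain ⟨z, hz⟩ := hprinc.principal
  have hz : J = Submodule.span O {z} := hz
  have hJI : ∀ t ∈ J, ∃ d ∈ I, t = algebraMap R F d := by
    intro t ht
    induction ht using Submodule.span_induction with
    | mem t h =>
      obtain ⟨i, rfl⟩ := h
      exact ⟨x i, hx i, rfl⟩
    | zero => exact ⟨0, I.zero_mem, by simp⟩
    | add s t _ _ hs ht =>
      obtain ⟨d, hd, rfl⟩ := hs
      obtain ⟨e, he, rfl⟩ := ht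
      exact ⟨d + e, I.add_mem hd he, by simp⟩
    | smul o t _ ht =>
      obtain ⟨d, hd, rfl⟩ := ht
      exact o.2 d hd
  obtain ⟨w, hwI, rfl⟩ := hJI z (hz ▸ Submodule.mem_span_singleton_self z)
  refine ⟨w, hwI, fun a ha b hb ↦ ?_⟩
  have haJ : algebraMap R F a ∈ J := by
    rw [← mul_one (algebraMap R F a), ← hxy, Finset.mul_sum]
    refine J.sum_mem fun i _ ↦ ?_
    rw [← mul_assoc]
    exact J.smul_mem (⟨_, fun c hc ↦ hy i a ha c hc⟩ : O) (Submodule.subset_span ⟨i, rfl⟩)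
  rw [hz, Submodule.mem_span_singleton] at haJ
  obtain ⟨o, ho⟩ := haJ
  obtain ⟨c, hc, hoc⟩ := o.2 b hb
  refine ⟨c, hc, IsFractionRing.injective R F ?_⟩
  rw [map_mul, map_mul, ← hoc, ← ho, Algebra.smul_def]
  change (o : F) * _ * _ = _ * ((o : F) * _)
  ring

theorem Ideal.IsStable.hasPrincipalSquare_of_fg {R : Type*} [CommRing R] [IsDomain R]
    [IsLocalRing R] {I : Ideal R} (hI : I ≠ ⊥) (hfg : I.FG) (h : I.IsStable) :
    I.HasPrincipalSquare := by
  let F := FractionRing R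
  obtain ⟨n, x, y, hx, hxy, hy⟩ := h.exists_dual_basis F hI
  let O := I.multiplierSubalgebra F
  suffices Module.Finite R O from
    I.exists_square_eq_of_dual_basis (finite_setOf_isMaximal_of_finite R O) hx hxy hy
  obtain ⟨m, g, hg⟩ := Submodule.fg_iff_exists_fin_generating_family.mp hfg
  have hgI : ∀ j, g j ∈ I := fun j ↦ hg ▸ Submodule.subset_span ⟨j, rfl⟩
  -- Writing `t = ∑ y i * (t * x i)` with `t * x i ∈ I` shows that the products `g j * y i` generate
  -- `O`, so `O` is finite over `R` and hence semilocal.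
  have key : Subalgebra.toSubmodule O = Submodule.span R
      (Set.range fun p : Fin n × Fin m ↦ algebraMap R F (g p.2) * y p.1) := by
    apply le_antisymm
    · intro t ht
      rw [← mul_one t, ← hxy, Finset.mul_sum]
      refine Submodule.sum_mem _ fun i _ ↦ ?_
      obtain ⟨d, hd, h1⟩ := ht (x i) (hx i)
      rw [mul_left_comm, h1]
      rw [← hg, Submodule.mem_span_range_iff_exists_fun] at hd
      obtain ⟨c, rfl⟩ := hd
      rw [map_sum, Finset.mul_sum]
      refine Submodule.sum_mem _ fun j _ ↦ ?_
      rw [smul_eq_mul, map_mul, mul_comm, mul_assoc, ← Algebra.smul_def]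
      exact Submodule.smul_mem _ _ (Submodule.subset_span ⟨(i, j), rfl⟩)
    · rw [Submodule.span_le]
      rintro _ ⟨p, rfl⟩
      exact fun c hc ↦ hy p.1 (g p.2) (hgI _) c hc
  refine Module.Finite.of_fg (N := Subalgebra.toSubmodule O) ?_
  rw [key]
  exact Submodule.fg_span (Set.finite_range _)

/-- Finite generation is avoided by passing to the ideal `J ⊆ I` generated by the `x i` of a dual
basis. It is stable too, so `J² = zJ`; inserting `(∑ y i * x i)² = 1` into `a * b` carries the
factor `z` over to `I²`. -/
theorem IsStableRing.hasPrincipalSquare {R : Type*} [CommRing R] [IsDomain R]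
    [IsLocalRing R] (h : IsStableRing R) (I : Ideal R) (hI : I ≠ ⊥) : I.HasPrincipalSquare := by
  let F := FractionRing R
  obtain ⟨n, x, y, hx, hxy, hy⟩ := (h I hI).exists_dual_basis F hI
  let J : Ideal R := Ideal.span (Set.range x)
  have hJI : J ≤ I := by
    rw [Ideal.span_le]
    rintro _ ⟨i, rfl⟩
    exact hx i
  have hJ : J ≠ ⊥ := by
    intro h0
    have : ∀ i, x i = 0 := fun i ↦ by
      rw [← Ideal.mem_bot, ← h0]
      exact Ideal.subset_span ⟨i, rfl⟩
    simp [this] at hxy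
  obtain ⟨z, hz, hsq⟩ :=
    (h J hJ).hasPrincipalSquare_of_fg hJ (Submodule.fg_span (Set.finite_range _))
  refine ⟨z, hJI hz, fun a ha b hb ↦ ?_⟩
  choose c hc hxc using fun i j ↦
    hsq (x i) (Ideal.subset_span ⟨i, rfl⟩) (x j) (Ideal.subset_span ⟨j, rfl⟩)
  choose d hd hyd using fun i j ↦ hy i a ha (c i j) (hJI (hc i j))
  choose e he hye using fun i j ↦ hy j b hb (d i j) (hd i j)
  refine ⟨∑ i, ∑ j, e i j, Ideal.sum_mem _ fun i _ ↦ Ideal.sum_mem _ fun j _ ↦ he i j, ?_⟩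
  apply IsFractionRing.injective R F
  have h1 : algebraMap R F (a * b) = algebraMap R F a * algebraMap R F b *
      (∑ i, y i * algebraMap R F (x i)) * (∑ i, y i * algebraMap R F (x i)) := by
    rw [hxy]
    simp
  rw [h1, map_mul, map_sum, mul_assoc, Finset.sum_mul_sum, Finset.mul_sum, Finset.mul_sum]
  refine Finset.sum_congr rfl fun i _ ↦ ?_
  rw [map_sum, Finset.mul_sum, Finset.mul_sum]
  refine Finset.sum_congr rfl fun j _ ↦ ?_
  have h2 := congrArg (algebraMap R F) (hxc i j)
  rw [map_mul, map_mul] at h2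
  rw [← hye, ← hyd]
  linear_combination (algebraMap R F a * algebraMap R F b * y i * y j) * h2

/-! ### The normalization is quadratic and Bézout -/

/-- Divide a monic equation of degree `n` by `x^(n-1)`. In terms of the reversed polynomial, this
uses that its constant term is `1`. -/
theorem IsIntegral.mem_adjoin_inv {R F : Type*} [CommRing R] [Field F] [Algebra R F] {x : F}
    (hx : IsIntegral R x) : x ∈ Algebra.adjoin R {x⁻¹} := by
  rcases eq_or_ne x 0 with rfl | hx0
  · exact Subalgebra.zero_mem _
  obtain ⟨p, hp, hpx⟩ := hx
  let := invertibleOfNonzero hx0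
  have h1 := Polynomial.eval₂_reverse_mul_pow (algebraMap R F) x p
  rw [hpx, invOf_eq_inv] at h1
  have h2 := (mul_eq_zero.mp h1).resolve_right (pow_ne_zero _ hx0)
  rw [← Polynomial.divX_mul_X_add p.reverse, Polynomial.eval₂_add, Polynomial.eval₂_mul,
    Polynomial.eval₂_X, Polynomial.eval₂_C, Polynomial.coeff_zero_reverse, hp.leadingCoeff,
    map_one] at h2
  have h3 : x = -Polynomial.aeval x⁻¹ p.reverse.divX := by
    rw [Polynomial.aeval_def]
    linear_combination x * h2 -
      Polynomial.eval₂ (algebraMap R F) x⁻¹ p.reverse.divX * mul_inv_cancel₀ hx0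
  have h4 := Subalgebra.neg_mem _ (Polynomial.aeval_mem_adjoin_singleton R x⁻¹ (p := p.reverse.divX))
  rwa [← h3] at h4

theorem Ideal.isIntegral_of_mem_multiplierSubalgebra {R F : Type*} [CommRing R] [IsDomain R]
    [Field F] [Algebra R F] [IsFractionRing R F] {I : Ideal R} (hI : I ≠ ⊥) (hfg : I.FG) {t : F}
    (ht : t ∈ I.multiplierSubalgebra F) : IsIntegral R t := by
  refine isIntegral_of_smul_mem_submodule (Submodule.map (Algebra.linearMap R F) I) ?_
    (Submodule.FG.map _ hfg) t ?_
  · obtain ⟨a, ha, ha0⟩ := Submodule.exists_mem_ne_zero_of_ne_bot hI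
    intro h
    have : algebraMap R F a ∈ Submodule.map (Algebra.linearMap R F) I := ⟨a, ha, rfl⟩
    rw [h, Submodule.mem_bot] at this
    exact ha0 (by simpa using this)
  · rintro _ ⟨c, hc, rfl⟩
    obtain ⟨d, hd, h⟩ := ht c hc
    exact ⟨d, hd, h.symm⟩

theorem exists_common_denominator {R F : Type*} [CommRing R] [IsDomain R] [Field F] [Algebra R F]
    [IsFractionRing R F] (s t : F) : ∃ d a b : R, d ≠ 0 ∧
      algebraMap R F d * s = algebraMap R F a ∧ algebraMap R F d * t = algebraMap R F b := by
  obtain ⟨a, d, hd, rfl⟩ := IsFractionRing.div_surjective (A := R) s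
  obtain ⟨b, e, he, rfl⟩ := IsFractionRing.div_surjective (A := R) t
  have hd0 := nonZeroDivisors.ne_zero hd
  have he0 := nonZeroDivisors.ne_zero he
  have hd' : algebraMap R F d ≠ 0 := by simpa using hd0
  have he' : algebraMap R F e ≠ 0 := by simpa using he0
  refine ⟨d * e, a * e, b * d, mul_ne_zero hd0 he0, ?_, ?_⟩
  · rw [map_mul, map_mul]; field_simp
  · rw [map_mul, map_mul]; field_simp

/-- If nonzero ideals of `R` have principal squares, then `R + Rs + Rt` is a ring for all
elements `s`, `t` integral over `R`. -/
theorem IsIntegral.exists_mul_eq_of_hasPrincipalSquare {R F : Type*} [CommRing R] [IsDomain R]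
    [Field F] [Algebra R F] [IsFractionRing R F]
    (h : ∀ I : Ideal R, I ≠ ⊥ → I.HasPrincipalSquare) {s t : F} (hs : IsIntegral R s)
    (ht : IsIntegral R t) : ∃ α β γ : R,
      s * t = algebraMap R F α + algebraMap R F β * s + algebraMap R F γ * t := by
  obtain ⟨d, a, b, hd0, hda, hdb⟩ := exists_common_denominator (R := R) s t
  have hd' : algebraMap R F d ≠ 0 := by simpa using hd0
  -- This is `d(R + Rs + Rt)`, so the goal amounts to `s ∈ (I : I)`.
  let I : Ideal R := Ideal.span {d, a, b}
  have hdI : d ∈ I := Ideal.subset_span (by simp)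
  have haI : a ∈ I := Ideal.subset_span (by simp)
  have hbI : b ∈ I := Ideal.subset_span (by simp)
  have hI : I ≠ ⊥ := fun h0 ↦ hd0 (by rwa [h0, Ideal.mem_bot] at hdI)
  obtain ⟨z, hz, hz0, hsq⟩ := (h I hI).exists_ne_zero hI
  have hz' : algebraMap R F z ≠ 0 := by simpa using hz0
  have hspan : ∀ c ∈ I, ∃ α β γ : R, c = α * d + β * a + γ * b := by
    intro c hc
    obtain ⟨α, β, γ, h⟩ := Submodule.mem_span_triple.mp hc
    exact ⟨α, β, γ, h.symm⟩
  let E := I.multiplierSubalgebra F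
  have hE : ∀ c ∈ I, algebraMap R F c / algebraMap R F z ∈ E := by
    intro c hc e he
    obtain ⟨f, hf, hcf⟩ := hsq c hc e he
    refine ⟨f, hf, ?_⟩
    rw [div_mul_eq_mul_div, ← map_mul, hcf, map_mul, mul_div_cancel_left₀ _ hz']
  have hx : algebraMap R F z / algebraMap R F d ∈ E := by
    have h1 : IsIntegral R (algebraMap R F z / algebraMap R F d) := by
      obtain ⟨α, β, γ, hc⟩ := hspan z hz
      have h2 : algebraMap R F z / algebraMap R F d =
          algebraMap R F α + algebraMap R F β * s + algebraMap R F γ * t := by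
        rw [div_eq_iff hd', hc, map_add, map_add, map_mul, map_mul, map_mul, ← hda, ← hdb]
        ring
      rw [h2]
      exact (isIntegral_algebraMap.add (isIntegral_algebraMap.mul hs)).add
        (isIntegral_algebraMap.mul ht)
    -- The inverse `d/z` of `z/d` lies in `E`, and `z/d` is integral, so `z/d ∈ R[d/z] ⊆ E`. Then `s
    -- = (z/d)(a/z)` is in `E`.
    refine Algebra.adjoin_le ?_ h1.mem_adjoin_inv
    rw [Set.singleton_subset_iff, inv_div]
    exact hE d hdI
  obtain ⟨e, he, hab⟩ := E.mul_mem hx (hE a haI) b hbI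
  obtain ⟨α, β, γ, rfl⟩ := hspan e he
  refine ⟨α, β, γ, ?_⟩
  simp only [map_add, map_mul, ← hda, ← hdb] at hab
  field_simp at hab
  linear_combination hab

/-- With `s = a/d`, `t = b/d` and `I = (a, b)`, the relation `I² = zI` puts `a/z` and `b/z` in `(I :
I)`, which is integral over `R`. So `z/d`, a combination of `s` and `t`, divides both. -/
theorem IsIntegral.exists_gcd_of_hasPrincipalSquare {R F : Type*} [CommRing R] [IsDomain R]
    [Field F] [Algebra R F] [IsFractionRing R F]
    (h : ∀ I : Ideal R, I ≠ ⊥ → I.HasPrincipalSquare) (s t : integralClosure R F) :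
    ∃ l m : integralClosure R F, l * s + m * t ∣ s ∧ l * s + m * t ∣ t := by
  obtain ⟨d, a, b, hd0, hda, hdb⟩ := exists_common_denominator (R := R) (s : F) (t : F)
  have hd' : algebraMap R F d ≠ 0 := by simpa using hd0
  let I : Ideal R := Ideal.span {a, b}
  have haI : a ∈ I := Ideal.subset_span (by simp)
  have hbI : b ∈ I := Ideal.subset_span (by simp)
  by_cases hI : I = ⊥
  · rw [hI, Ideal.mem_bot] at haI hbI
    have hs : s = 0 := by
      ext
      simpa [haI, hd0] using hda
    have ht : t = 0 := by
      ext
      simpa [hbI, hd0] using hdb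
    exact ⟨0, 0, by simp [hs], by simp [ht]⟩
  obtain ⟨z, hz, hz0, hsq⟩ := (h I hI).exists_ne_zero hI
  have hz' : algebraMap R F z ≠ 0 := by simpa using hz0
  have hE : ∀ c ∈ I, IsIntegral R (algebraMap R F c / algebraMap R F z) := by
    intro c hc
    refine Ideal.isIntegral_of_mem_multiplierSubalgebra hI
      (Submodule.fg_span (Set.toFinite _)) fun e he ↦ ?_
    obtain ⟨f, hf, hcf⟩ := hsq c hc e he
    refine ⟨f, hf, ?_⟩
    rw [div_mul_eq_mul_div, ← map_mul, hcf, map_mul, mul_div_cancel_left₀ _ hz']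
  obtain ⟨l, m, hlm⟩ := Ideal.mem_span_pair.mp hz
  have hlm' : algebraMap R F d * (algebraMap R F l * s + algebraMap R F m * t) =
      algebraMap R F z := by
    rw [← hlm, map_add, map_mul, map_mul, ← hda, ← hdb]
    ring
  refine ⟨algebraMap R _ l, algebraMap R _ m, ⟨⟨_, hE a haI⟩, ?_⟩, ⟨⟨_, hE b hbI⟩, ?_⟩⟩
  · apply Subtype.ext
    change (s : F) = (algebraMap R F l * s + algebraMap R F m * t) * (_ / _)
    rw [mul_div_assoc', eq_div_iff hz', ← hlm', ← hda]
    ring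
  · apply Subtype.ext
    change (t : F) = (algebraMap R F l * s + algebraMap R F m * t) * (_ / _)
    rw [mul_div_assoc', eq_div_iff hz', ← hlm', ← hdb]
    ring

/-! ### Quadratic algebras over a field with a nontrivial idempotent -/

section QuadraticAlgebraOverField

variable {k A : Type*} [Field k] [CommRing A] [Algebra k A]

/-- Since `e * g = 0`, the product `f * g` equals `(e + f) * g`. Comparing the quadratic expansions
of the two kills the coefficients of `1`, `e` and `f`. -/
theorem exists_mul_eq_smul_of_idempotent {e f g : A} (he : e * e = e) (he0 : e ≠ 0)
    (hq : ∀ a b : A, ∃ x y z : k, a * b = x • 1 + y • a + z • b)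
    (hf : e * f = 0) (hg : e * g = 0)
    (hind : ∀ x y z : k, x • (1 - e) + y • f + z • g = 0 → x = 0 ∧ y = 0 ∧ z = 0) :
    ∃ z : k, f * g = z • g := by
  obtain ⟨x, y, z, h1⟩ := hq (e + f) g
  obtain ⟨x', y', z', h2⟩ := hq f g
  have h3 : (x + y) • e = 0 := by
    have : e * ((e + f) * g) = e * (x • 1 + y • (e + f) + z • g) := by rw [h1]
    simp only [mul_add, mul_smul_comm, mul_one, he, hf, hg, smul_zero, add_zero, add_mul] at this
    rw [← mul_assoc e f g, hf] at this
    simpa [add_smul] using this.symm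
  have h4 : x' • e = 0 := by
    have : e * (f * g) = e * (x' • 1 + y' • f + z' • g) := by rw [h2]
    simp only [mul_add, mul_smul_comm, mul_one, hf, hg, smul_zero, add_zero] at this
    rw [← mul_assoc, hf] at this
    simpa using this.symm
  have hxy : x = -y := eq_neg_of_add_eq_zero_left ((smul_eq_zero.mp h3).resolve_right he0)
  have hx' : x' = 0 := (smul_eq_zero.mp h4).resolve_right he0
  subst hxy hx'
  have h5 : f * g = -y • 1 + y • (e + f) + z • g := by
    rw [← h1, add_mul, hg, zero_add]
  obtain ⟨hy, -, -⟩ := hind y (y' - y) (z' - z) (by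
    have h6 := h5.symm.trans h2
    rw [← sub_eq_zero.mpr h6.symm]
    module)
  refine ⟨z, ?_⟩
  rw [h5, hy]
  simp

/-- Otherwise `1 - e` and the components `f`, `g` of `p`, `q` in `(1 - e)A` are independent. By
symmetry `f * g` is a multiple of both `f` and `g`, hence zero; the same holds with `(1 - e) + f` in
place of `f`, which forces `g = 0`. -/
theorem exists_span_of_idempotent_mul {e : A} (he : e * e = e) (he0 : e ≠ 0) (he1 : 1 - e ≠ 0)
    (hq : ∀ a b : A, ∃ x y z : k, a * b = x • 1 + y • a + z • b)
    (hE : ∀ p : A, ∃ c : k, e * p = c • e) :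
    ∃ p : A, ∀ q : A, ∃ x y z : k, q = x • 1 + y • e + z • p := by
  by_contra! hcon
  obtain ⟨p, hp⟩ := hcon 0
  obtain ⟨q, hq'⟩ := hcon p
  obtain ⟨c, hc⟩ := hE p
  obtain ⟨d, hd⟩ := hE q
  have hind : ∀ x y z : k,
      x • (1 - e) + y • (p - c • e) + z • (q - d • e) = 0 → x = 0 ∧ y = 0 ∧ z = 0 := by
    intro x y z h
    have hz : z = 0 := by
      by_contra hz
      apply hq' (-(z⁻¹ * x)) (z⁻¹ * (x + y * c + z * d)) (-(z⁻¹ * y))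
      have h1 : z • q = -x • 1 + (x + y * c + z * d) • e + -y • p := by
        rw [← sub_eq_zero, ← h]
        module
      rw [← inv_smul_smul₀ hz q, h1]
      module
    subst hz
    have hy : y = 0 := by
      by_contra hy
      apply hp (-(y⁻¹ * x)) (y⁻¹ * (x + y * c)) 0
      have h1 : y • p = -x • 1 + (x + y * c) • e := by
        rw [← sub_eq_zero, ← h]
        module
      rw [← inv_smul_smul₀ hy p, h1]
      module
    subst hy
    refine ⟨?_, rfl, rfl⟩
    simp only [zero_smul, add_zero] at h
    exact (smul_eq_zero.mp h).resolve_right he1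
  have hzero : ∀ f g : A, e * f = 0 → e * g = 0 →
      (∀ x y z : k, x • (1 - e) + y • f + z • g = 0 → x = 0 ∧ y = 0 ∧ z = 0) → f * g = 0 := by
    intro f g hf hg h
    obtain ⟨z, hz⟩ := exists_mul_eq_smul_of_idempotent he he0 hq hf hg h
    obtain ⟨w, hw⟩ := exists_mul_eq_smul_of_idempotent he he0 hq hg hf (fun x y z h' ↦ by
      obtain ⟨h1, h2, h3⟩ := h x z y (by rw [← h']; abel)
      exact ⟨h1, h3, h2⟩)
    obtain ⟨-, -, hz0⟩ := h 0 (-w) z (by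
      rw [← hz, neg_smul, ← hw, mul_comm g f]
      simp)
    rw [hz, hz0, zero_smul]
  have hf : e * (p - c • e) = 0 := by rw [mul_sub, hc, mul_smul_comm, he, sub_self]
  have hg : e * (q - d • e) = 0 := by rw [mul_sub, hd, mul_smul_comm, he, sub_self]
  have hf' : e * ((1 - e) + (p - c • e)) = 0 := by rw [mul_add, hf, mul_sub, he]; simp
  have h1 := hzero _ _ hf hg hind
  have h2 := hzero _ _ hf' hg (fun x y z h ↦ by
    obtain ⟨h1, h2, h3⟩ := hind (x + y) y z (by rw [← h]; module)
    exact ⟨by simpa [h2] using h1, h2, h3⟩)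
  have h3 : q - d • e = 0 := by
    rw [add_mul, h1, add_zero, sub_mul, hg] at h2
    simpa using h2
  simpa using (hind 0 0 1 (by simp [h3])).2.2

/-- A `k`-algebra with a nontrivial idempotent in which every `k + ka + kb` is closed under
multiplication has dimension at most three. -/
theorem exists_span_of_idempotent {e : A} (he : e * e = e) (he0 : e ≠ 0) (he1 : 1 - e ≠ 0)
    (hq : ∀ a b : A, ∃ x y z : k, a * b = x • 1 + y • a + z • b) :
    ∃ p : A, ∀ q : A, ∃ x y z : k, q = x • 1 + y • e + z • p := by
  have key : ∀ p : A, (∃ c : k, e * p = c • e) ∨ ∃ c : k, (1 - e) * p = c • (1 - e) := by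
    intro p
    obtain ⟨x, y, z, h⟩ := hq e p
    by_cases hz : z = 1
    · right
      refine ⟨-x, ?_⟩
      have h1 : (1 - e) * (e * p) = (1 - e) * (x • 1 + y • e + z • p) := by rw [h]
      have h2 : (1 - e) * (e * p) = 0 := by linear_combination (-p) * he
      have h3 : (1 - e) * e = 0 := by linear_combination -he
      rw [h2, hz, one_smul, mul_add, mul_add, mul_smul_comm, mul_smul_comm, h3, mul_one,
        smul_zero, add_zero] at h1
      rw [neg_smul]
      exact eq_neg_of_add_eq_zero_right h1.symm
    · left
      have hz' : 1 - z ≠ 0 := sub_ne_zero.mpr (Ne.symm hz)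
      refine ⟨(1 - z)⁻¹ * (x + y), ?_⟩
      have h1 : e * (e * p) = e * (x • 1 + y • e + z • p) := by rw [h]
      rw [← mul_assoc, he, mul_add, mul_add, mul_smul_comm, mul_smul_comm, mul_smul_comm, he,
        mul_one] at h1
      have h2 : (1 - z) • (e * p) = (x + y) • e := by
        rw [sub_smul, one_smul, sub_eq_iff_eq_add, add_smul]
        exact h1
      rw [mul_smul, ← h2, inv_smul_smul₀ hz']
  by_cases h1 : ∀ p : A, ∃ c : k, e * p = c • e
  · exact exists_span_of_idempotent_mul he he0 he1 hq h1
  · have h2 : ∀ p : A, ∃ c : k, (1 - e) * p = c • (1 - e) := by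
      push Not at h1
      obtain ⟨p, hp⟩ := h1
      intro q
      obtain ⟨c, hc⟩ := (key p).resolve_left (by simpa using hp)
      rcases key q with ⟨d, hd⟩ | h
      · rcases key (p + q) with ⟨d', hd'⟩ | ⟨d', hd'⟩
        · refine absurd ?_ (hp (d' - d))
          rw [mul_add] at hd'
          rw [sub_smul, ← hd', ← hd, add_sub_cancel_right]
        · refine ⟨d' - c, ?_⟩
          rw [mul_add] at hd'
          rw [sub_smul, ← hd', ← hc, add_sub_cancel_left]
      · exact h
    obtain ⟨p, hp⟩ := exists_span_of_idempotent_mul (e := 1 - e) (by linear_combination he) he1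
      (by simpa using he0) hq h2
    refine ⟨p, fun q ↦ ?_⟩
    obtain ⟨x, y, z, h⟩ := hp q
    exact ⟨x + y, -y, z, by rw [h]; module⟩

end QuadraticAlgebraOverField

/-! ### Quadratic integral extensions of a local ring -/

/-- `R + Rs + Rt` is closed under multiplication for all `s`, `t` in the `R`-algebra `S`. -/
def IsQuadraticAlgebra (R S : Type*) [CommRing R] [CommRing S] [Algebra R S] : Prop :=
  ∀ s t : S, ∃ α β γ : R, s * t = algebraMap R S α + algebraMap R S β * s + algebraMap R S γ * t

section

variable {R S : Type*} [CommRing R] [CommRing S] [Algebra R S]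

theorem IsQuadraticAlgebra.sq_eq (hq : IsQuadraticAlgebra R S) (s : S) :
    ∃ α β : R, s * s = algebraMap R S α + algebraMap R S β * s := by
  obtain ⟨α, β, γ, h⟩ := hq s s
  exact ⟨α, β + γ, by rw [h, map_add]; ring⟩

theorem IsQuadraticAlgebra.mem_adjoin_iff (hq : IsQuadraticAlgebra R S) {s t : S} :
    t ∈ Algebra.adjoin R {s} ↔ ∃ α β : R, t = algebraMap R S α + algebraMap R S β * s := by
  constructor
  · intro ht
    induction ht using Algebra.adjoin_induction with
    | mem t h => exact ⟨0, 1, by simpa using h⟩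
    | algebraMap r => exact ⟨r, 0, by simp⟩
    | add a b _ _ ha hb =>
      obtain ⟨α, β, rfl⟩ := ha
      obtain ⟨γ, δ, rfl⟩ := hb
      exact ⟨α + γ, β + δ, by simp only [map_add]; ring⟩
    | mul a b _ _ ha hb =>
      obtain ⟨α, β, rfl⟩ := ha
      obtain ⟨γ, δ, rfl⟩ := hb
      obtain ⟨x, y, h⟩ := hq.sq_eq s
      refine ⟨α * γ + β * δ * x, α * δ + β * γ + β * δ * y, ?_⟩
      simp only [map_add, map_mul]
      linear_combination algebraMap R S β * algebraMap R S δ * h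
  · rintro ⟨α, β, rfl⟩
    exact add_mem (Subalgebra.algebraMap_mem _ _)
      (mul_mem (Subalgebra.algebraMap_mem _ _) (Algebra.self_mem_adjoin_singleton R s))

/-- The inverse `w` of `u` satisfies `w² = α + βw`; multiplying by `u` gives `w = αu + β ∈ B`. -/
theorem IsQuadraticAlgebra.mem_of_isUnit_of_mul_mem (hq : IsQuadraticAlgebra R S)
    {B : Subalgebra R S} {u t : S} (hu : IsUnit u) (huB : u ∈ B) (h : u * t ∈ B) : t ∈ B := by
  obtain ⟨w, hw⟩ := hu.exists_left_inv
  obtain ⟨α, β, h1⟩ := hq.sq_eq w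
  have h2 : w = algebraMap R S α * u + algebraMap R S β := by
    linear_combination (-w + algebraMap R S β) * hw + u * h1
  have hwB : w ∈ B := by
    rw [h2]
    exact add_mem (mul_mem (Subalgebra.algebraMap_mem _ _) huB) (Subalgebra.algebraMap_mem _ _)
  have h3 : t = w * (u * t) := by linear_combination (-t) * hw
  rw [h3]
  exact mul_mem hwB h

theorem Algebra.IsIntegral.adjoin_ne_top [Algebra.IsIntegral R S] (hnf : ¬ Module.Finite R S)
    {T : Set S} (hT : T.Finite) : Algebra.adjoin R T ≠ ⊤ := by
  intro h
  have : Algebra.FiniteType R S := ⟨⟨hT.toFinset, by simpa using h⟩⟩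
  exact hnf Algebra.IsIntegral.finite

theorem algebraMap_mem_iff_mem_maximalIdeal [IsLocalRing R] [Algebra.IsIntegral R S]
    {N : Ideal S} (hN : N.IsMaximal) {r : R} :
    algebraMap R S r ∈ N ↔ r ∈ IsLocalRing.maximalIdeal R := by
  have := Ideal.isMaximal_comap_of_isIntegral_of_isMaximal (R := R) N
  rw [← IsLocalRing.eq_maximalIdeal this, Ideal.mem_comap]

theorem isUnit_of_forall_notMem_maximal {s : S} (h : ∀ N : Ideal S, N.IsMaximal → s ∉ N) :
    IsUnit s := by
  by_contra hs
  obtain ⟨N, hN, hsN⟩ := exists_max_ideal_of_mem_nonunits hs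
  exact h N hN hsN

theorem isUnit_algebraMap_of_notMem [IsLocalRing R] {r : R}
    (hr : r ∉ IsLocalRing.maximalIdeal R) : IsUnit (algebraMap R S r) :=
  (IsLocalRing.notMem_maximalIdeal.mp hr).map _

/-- The coefficient `a` is in `m` at once. If `b` is a unit, then so is `p - b`; expressing its
inverse linearly in `p` shows that `p` is the image of some `r ∈ m`, and `p² = 0 + rp` serves
instead. -/
theorem IsQuadraticAlgebra.sq_eq_of_mem_jacobson [IsLocalRing R] [Algebra.IsIntegral R S]
    [Nontrivial S] (hq : IsQuadraticAlgebra R S) {p : S}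
    (hp : ∀ N : Ideal S, N.IsMaximal → p ∈ N) :
    ∃ a ∈ IsLocalRing.maximalIdeal R, ∃ b ∈ IsLocalRing.maximalIdeal R,
      p * p = algebraMap R S a + algebraMap R S b * p := by
  obtain ⟨N, hN⟩ := Ideal.exists_maximal S
  obtain ⟨a, b, h⟩ := hq.sq_eq p
  have ha : a ∈ IsLocalRing.maximalIdeal R := by
    rw [← algebraMap_mem_iff_mem_maximalIdeal hN]
    have h1 : algebraMap R S a = (p - algebraMap R S b) * p := by linear_combination -h
    rw [h1]
    exact N.mul_mem_left _ (hp N hN)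
  by_cases hb : b ∈ IsLocalRing.maximalIdeal R
  · exact ⟨a, ha, b, hb, h⟩
  have hu : IsUnit (p - algebraMap R S b) := isUnit_of_forall_notMem_maximal fun M hM hmem ↦ by
    have h1 := M.sub_mem (hp M hM) hmem
    rw [sub_sub_cancel, algebraMap_mem_iff_mem_maximalIdeal hM] at h1
    exact hb h1
  obtain ⟨w, hw⟩ := hu.exists_left_inv
  obtain ⟨c, d, h1⟩ := hq.sq_eq w
  have h2 : w = algebraMap R S c * (p - algebraMap R S b) + algebraMap R S d := by
    linear_combination (-w + algebraMap R S d) * hw + (p - algebraMap R S b) * h1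
  have h3 : (p - algebraMap R S b) * p = algebraMap R S a := by linear_combination h
  have h4 : p = algebraMap R S a * w := by
    rw [← h3]
    linear_combination (-p) * hw
  have hu' : IsUnit (1 - a * c) := by
    rw [← IsLocalRing.notMem_maximalIdeal]
    intro h5
    apply (Ideal.ne_top_iff_one _).mp (IsLocalRing.maximalIdeal.isMaximal R).ne_top
    have h6 := Ideal.add_mem _ h5 (Ideal.mul_mem_right c _ ha)
    rwa [sub_add_cancel] at h6
  obtain ⟨v, hv⟩ := hu'.exists_left_inv
  have hv' := congrArg (algebraMap R S) hv
  simp only [map_mul, map_sub, map_one] at hv'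
  have h7 : p = algebraMap R S (v * (a * d - a * c * b)) := by
    simp only [map_mul, map_sub]
    have h8 : p = algebraMap R S a * (algebraMap R S c * (p - algebraMap R S b) +
      algebraMap R S d) := by rw [← h2]; exact h4
    linear_combination algebraMap R S v * h8 - p * hv'
  refine ⟨0, zero_mem _, v * (a * d - a * c * b), ?_, ?_⟩
  · exact Ideal.mul_mem_left _ _ (Ideal.sub_mem _ (Ideal.mul_mem_right _ _ ha)
      (Ideal.mul_mem_right _ _ (Ideal.mul_mem_right _ _ ha)))
  · rw [← h7]
    simp

/-- The expansion of `sp` gives `(s - ν)p ∈ R[s]`. If `ν² - ν` is a unit, so is `s - ν`. If not, `2ν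
- 1` is a unit since its square is `1` modulo `m`, and the expansion of `(s + p)²` gives a unit
multiple of `p` in `R[s]`. -/
theorem IsQuadraticAlgebra.mem_adjoin_of_mem_jacobson [IsLocalRing R] [Algebra.IsIntegral R S]
    (hq : IsQuadraticAlgebra R S) {s : S} {α : R} (hα : α ∈ IsLocalRing.maximalIdeal R)
    (hs : s * s = s + algebraMap R S α) {N₁ N₂ : Ideal S} (hN₁ : N₁.IsMaximal)
    (hN₂ : N₂.IsMaximal) (h₁ : s ∈ N₁) (h₂ : s ∉ N₂)
    {p : S} (hp : ∀ N : Ideal S, N.IsMaximal → p ∈ N) : p ∈ Algebra.adjoin R {s} := by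
  have : Nontrivial S := ⟨s, 0, fun h ↦ h₂ (h ▸ N₂.zero_mem)⟩
  have hs2 : s - 1 ∈ N₂ := by
    refine (hN₂.isPrime.mem_or_mem (x := s) ?_).resolve_left h₂
    have : s * (s - 1) = algebraMap R S α := by linear_combination hs
    rwa [this, algebraMap_mem_iff_mem_maximalIdeal hN₂]
  have hsB := Algebra.self_mem_adjoin_singleton R s
  obtain ⟨a, ha, b, hb, hpp⟩ := hq.sq_eq_of_mem_jacobson hp
  obtain ⟨α', β', hsp2⟩ := hq.sq_eq (s + p)
  obtain ⟨l, μ, ν, hsp⟩ := hq s p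
  have hα' : α' ∈ IsLocalRing.maximalIdeal R := by
    rw [← algebraMap_mem_iff_mem_maximalIdeal hN₁]
    have h1 : algebraMap R S α' = (s + p - algebraMap R S β') * (s + p) := by
      linear_combination -hsp2
    rw [h1]
    exact N₁.mul_mem_left _ (N₁.add_mem h₁ (hp _ hN₁))
  have hβ' : 1 - β' ∈ IsLocalRing.maximalIdeal R := by
    rw [← algebraMap_mem_iff_mem_maximalIdeal hN₂]
    have h1 : algebraMap R S (1 - β') = algebraMap R S α' - (s - 1) * (s + 1 - algebraMap R S β')
        - p * (p + 2 * s - algebraMap R S β') := by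
      rw [map_sub, map_one]
      linear_combination hsp2
    rw [h1]
    exact N₂.sub_mem (N₂.sub_mem ((algebraMap_mem_iff_mem_maximalIdeal hN₂).mpr hα')
      (N₂.mul_mem_right _ hs2)) (N₂.mul_mem_right _ (hp _ hN₂))
  by_cases hν : ν * ν - ν ∈ IsLocalRing.maximalIdeal R
  · have hu : 2 * ν + b - β' ∉ IsLocalRing.maximalIdeal R := by
      intro h
      apply (Ideal.ne_top_iff_one _).mp (IsLocalRing.maximalIdeal.isMaximal R).ne_top
      have h1 : 2 * ν - 1 ∈ IsLocalRing.maximalIdeal R := by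
        have : 2 * ν - 1 = (2 * ν + b - β') - b - (1 - β') := by ring
        rw [this]
        exact Ideal.sub_mem _ (Ideal.sub_mem _ h hb) hβ'
      have h2 : (1 : R) = (2 * ν - 1) * (2 * ν - 1) - 4 * (ν * ν - ν) := by ring
      rw [h2]
      exact Ideal.sub_mem _ (Ideal.mul_mem_left _ _ h1) (Ideal.mul_mem_left _ _ hν)
    refine hq.mem_of_isUnit_of_mul_mem (isUnit_algebraMap_of_notMem hu)
      (Subalgebra.algebraMap_mem _ _) ?_
    refine hq.mem_adjoin_iff.mpr ⟨α' - α - 2 * l - a, β' - 1 - 2 * μ, ?_⟩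
    simp only [map_add, map_sub, map_mul, map_one, map_ofNat]
    linear_combination hsp2 - hs - hpp - 2 * hsp
  · have hu : IsUnit (s - algebraMap R S ν) := by
      refine isUnit_of_mul_isUnit_left (y := s - 1 + algebraMap R S ν) ?_
      have h1 : (s - algebraMap R S ν) * (s - 1 + algebraMap R S ν) =
          algebraMap R S (α - (ν * ν - ν)) := by
        simp only [map_sub, map_mul]
        linear_combination hs
      rw [h1]
      refine isUnit_algebraMap_of_notMem fun h ↦ hν ?_
      have h2 := Ideal.sub_mem _ hα h
      rwa [sub_sub_cancel] at h2
    refine hq.mem_of_isUnit_of_mul_mem hu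
      (sub_mem hsB (Subalgebra.algebraMap_mem _ _)) ?_
    exact hq.mem_adjoin_iff.mpr ⟨l, μ, by linear_combination hsp⟩

/-- Pick `t ∉ R[s]`. The expansion of `st` gives `(s - ν)t ∈ R[s]`, so `s - ν` cannot be a unit. -/
theorem IsQuadraticAlgebra.exists_sub_mem_maximal [IsLocalRing R] [Algebra.IsIntegral R S]
    (hq : IsQuadraticAlgebra R S) (hnf : ¬ Module.Finite R S) (s : S) :
    ∃ (ν : R) (N : Ideal S), N.IsMaximal ∧ s - algebraMap R S ν ∈ N := by
  obtain ⟨t, ht⟩ := SetLike.exists_not_mem_of_ne_top _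
    (Algebra.IsIntegral.adjoin_ne_top hnf (Set.finite_singleton s)) rfl
  obtain ⟨α, β, ν, h⟩ := hq s t
  refine ⟨ν, exists_max_ideal_of_mem_nonunits fun hu ↦ ht ?_⟩
  refine hq.mem_of_isUnit_of_mul_mem hu (sub_mem (Algebra.self_mem_adjoin_singleton R s)
    (Subalgebra.algebraMap_mem _ _)) ?_
  exact hq.mem_adjoin_iff.mpr ⟨α, β, by linear_combination h⟩

/-- A quadratic integral extension of a local ring that is not finite is local with trivial
residue field extension. -/
theorem IsQuadraticAlgebra.exists_sub_mem_jacobson [IsLocalRing R] [Algebra.IsIntegral R S]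
    (hq : IsQuadraticAlgebra R S) (hnf : ¬ Module.Finite R S) (s : S) :
    ∃ ν : R, ∀ N : Ideal S, N.IsMaximal → s - algebraMap R S ν ∈ N := by
  by_contra! hcon
  obtain ⟨ν, N₁, hN₁, h₁⟩ := hq.exists_sub_mem_maximal hnf s
  obtain ⟨N₂, hN₂, h₂⟩ := hcon ν
  -- If `s - ν` separates two maximal ideals, its quadratic equation has a unit linear coefficient;
  -- rescaling by the inverse gives an element that is idempotent modulo `m`.
  obtain ⟨e, α, hα, he, h₁, h₂⟩ : ∃ (e : S) (α : R), α ∈ IsLocalRing.maximalIdeal R ∧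
      e * e = e + algebraMap R S α ∧ e ∈ N₁ ∧ e ∉ N₂ := by
    obtain ⟨α, β, h⟩ := hq.sq_eq (s - algebraMap R S ν)
    have hα : α ∈ IsLocalRing.maximalIdeal R := by
      rw [← algebraMap_mem_iff_mem_maximalIdeal hN₁]
      have h3 : algebraMap R S α =
          (s - algebraMap R S ν - algebraMap R S β) * (s - algebraMap R S ν) := by
        linear_combination -h
      rw [h3]
      exact N₁.mul_mem_left _ h₁
    have hβ : β ∉ IsLocalRing.maximalIdeal R := by
      intro hβ
      refine h₂ (or_self_iff.mp (hN₂.isPrime.mem_or_mem (h ▸ ?_)))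
      exact N₂.add_mem ((algebraMap_mem_iff_mem_maximalIdeal hN₂).mpr hα)
        (N₂.mul_mem_right _ ((algebraMap_mem_iff_mem_maximalIdeal hN₂).mpr hβ))
    obtain ⟨v, hv⟩ := (IsLocalRing.notMem_maximalIdeal.mp hβ).exists_left_inv
    have hv' := congrArg (algebraMap R S) hv
    simp only [map_mul, map_one] at hv'
    refine ⟨algebraMap R S v * (s - algebraMap R S ν), v * v * α, Ideal.mul_mem_left _ _ hα, ?_,
      N₁.mul_mem_left _ h₁, ?_⟩
    · simp only [map_mul]
      linear_combination algebraMap R S v ^ 2 * h +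
        algebraMap R S v * (s - algebraMap R S ν) * hv'
    · intro h3
      apply h₂
      have h4 := N₂.mul_mem_left (algebraMap R S β) h3
      rwa [← mul_assoc, mul_comm (algebraMap R S β), hv', one_mul] at h4
  let m := IsLocalRing.maximalIdeal R
  let J : Ideal S := (⊥ : Ideal S).jacobson
  have hJ : ∀ t ∈ J, ∀ N : Ideal S, N.IsMaximal → t ∈ N := fun t ht N hN ↦
    Ideal.mem_sInf.mp ht ⟨bot_le, hN⟩
  have hmJ : ∀ r ∈ m, Ideal.Quotient.mk J (algebraMap R S r) = 0 := fun r hr ↦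
    Ideal.Quotient.eq_zero_iff_mem.mpr (Ideal.mem_sInf.mpr fun N hN ↦
      (algebraMap_mem_iff_mem_maximalIdeal hN.2).mpr hr)
  let : Field (R ⧸ m) := Ideal.Quotient.field m
  let : Algebra (R ⧸ m) (S ⧸ J) :=
    (Ideal.Quotient.lift m ((Ideal.Quotient.mk J).comp (algebraMap R S)) hmJ).toAlgebra
  have hsmul : ∀ (r : R) (t : S), (Ideal.Quotient.mk m r) • (Ideal.Quotient.mk J t) =
      Ideal.Quotient.mk J (algebraMap R S r * t) := fun r t ↦ by
    rw [map_mul]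
    rfl
  have hquad : ∀ a b : S ⧸ J, ∃ x y z : R ⧸ m, a * b = x • 1 + y • a + z • b := by
    intro a b
    obtain ⟨a, rfl⟩ := Ideal.Quotient.mk_surjective a
    obtain ⟨b, rfl⟩ := Ideal.Quotient.mk_surjective b
    obtain ⟨x, y, z, h⟩ := hq a b
    refine ⟨Ideal.Quotient.mk m x, Ideal.Quotient.mk m y, Ideal.Quotient.mk m z, ?_⟩
    rw [← map_one (Ideal.Quotient.mk J), hsmul, hsmul, hsmul, ← map_mul, h, map_add, map_add,
      mul_one]
  obtain ⟨p, hp⟩ := exists_span_of_idempotent (k := R ⧸ m) (e := Ideal.Quotient.mk J e)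
    (by rw [← map_mul, he, map_add, hmJ α hα, add_zero])
    (fun h ↦ h₂ (hJ _ (Ideal.Quotient.eq_zero_iff_mem.mp h) N₂ hN₂))
    (fun h ↦ (Ideal.ne_top_iff_one _).mp hN₁.ne_top (by
      rw [← map_one (Ideal.Quotient.mk J), ← map_sub, Ideal.Quotient.eq_zero_iff_mem] at h
      have h3 := N₁.add_mem (hJ _ h N₁ hN₁) h₁
      rwa [sub_add_cancel] at h3)) hquad
  obtain ⟨p, rfl⟩ := Ideal.Quotient.mk_surjective p
  -- Modulo its Jacobson radical `S` is spanned by `1, e, p`, and the radical itself lies in `R[e]`;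
  -- so `S = R[e, p]` would be finite.
  refine Algebra.IsIntegral.adjoin_ne_top (R := R) hnf (T := {e, p}) (Set.toFinite _) ?_
  rw [eq_top_iff]
  rintro q -
  obtain ⟨x, y, z, h⟩ := hp (Ideal.Quotient.mk J q)
  obtain ⟨x, rfl⟩ := Ideal.Quotient.mk_surjective x
  obtain ⟨y, rfl⟩ := Ideal.Quotient.mk_surjective y
  obtain ⟨z, rfl⟩ := Ideal.Quotient.mk_surjective z
  rw [← map_one (Ideal.Quotient.mk J), hsmul, hsmul, hsmul, ← map_add, ← map_add,
    Ideal.Quotient.eq] at h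
  have h3 := hq.mem_adjoin_of_mem_jacobson hα he hN₁ hN₂ h₁ h₂ (hJ _ h)
  have h4 : q - (algebraMap R S x * 1 + algebraMap R S y * e + algebraMap R S z * p) ∈
      Algebra.adjoin R {e, p} := Algebra.adjoin_mono (by simp) h3
  have heB : e ∈ Algebra.adjoin R {e, p} := Algebra.subset_adjoin (by simp)
  have hpB : p ∈ Algebra.adjoin R {e, p} := Algebra.subset_adjoin (by simp)
  have h5 := add_mem h4 (add_mem (add_mem (mul_mem (Subalgebra.algebraMap_mem _ x) (one_mem _))
    (mul_mem (Subalgebra.algebraMap_mem _ y) heB)) (mul_mem (Subalgebra.algebraMap_mem _ z) hpB))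
  rwa [sub_add_cancel] at h5

end

/-! ### The normalization as a valuation ring with uniformizer in `R` -/

theorem exists_dvd_pow_of_ringKrullDim_eq_one {R : Type*} [CommRing R] [IsDomain R]
    [IsLocalRing R] (hR : ringKrullDim R = 1) {x w : R} (hx : x ≠ 0)
    (hw : w ∈ IsLocalRing.maximalIdeal R) : ∃ n, x ∣ w ^ n := by
  obtain ⟨n, hn⟩ := (ringKrullDim_eq_one_iff_of_isLocalRing_isDomain.mp hR).2 x hx hw
  exact ⟨n, Ideal.mem_span_singleton.mp hn⟩

theorem dimensionLEOne_of_ringKrullDim_eq_one {R : Type*} [CommRing R] [IsDomain R]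
    [IsLocalRing R] (hR : ringKrullDim R = 1) : Ring.DimensionLEOne R := by
  refine ⟨fun {p} hp hprime ↦ ?_⟩
  obtain ⟨x, hx, hx0⟩ := Submodule.exists_mem_ne_zero_of_ne_bot hp
  have h1 : IsLocalRing.maximalIdeal R ≤ p := fun w hw ↦ by
    obtain ⟨n, hn⟩ := exists_dvd_pow_of_ringKrullDim_eq_one hR hx0 hw
    exact hprime.mem_of_pow_mem n (p.mem_of_dvd hn hx)
  rw [(IsLocalRing.maximalIdeal.isMaximal R).eq_of_le hprime.ne_top h1 |>.symm]
  infer_instance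

theorem exists_dvd_pow_of_dimensionLEOne {S : Type*} [CommRing S] [IsDomain S] [IsLocalRing S]
    [Ring.DimensionLEOne S] {x w : S} (hx : x ≠ 0) (hw : ¬ IsUnit w) : ∃ n, x ∣ w ^ n := by
  have h1 : w ∈ (Ideal.span {x}).radical := by
    rw [Ideal.radical_eq_sInf, Ideal.mem_sInf]
    rintro p ⟨hxp, hp⟩
    have hp0 : p ≠ ⊥ := fun h ↦ hx (by
      simpa [h] using hxp (Ideal.mem_span_singleton_self x))
    rw [IsLocalRing.eq_maximalIdeal (hp.isMaximal hp0)]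
    exact hw
  obtain ⟨n, hn⟩ := h1
  exact ⟨n, Ideal.mem_span_singleton.mp hn⟩

section

variable {R S : Type*} [CommRing R] [IsLocalRing R] [CommRing S] [IsDomain S] [Algebra R S]

theorem IsQuadraticAlgebra.isLocalRing [Algebra.IsIntegral R S] (hq : IsQuadraticAlgebra R S)
    (hnf : ¬ Module.Finite R S) : IsLocalRing S := by
  have h1 : ∀ s : S, ¬ IsUnit s → ∀ N : Ideal S, N.IsMaximal → s ∈ N := by
    intro s hs N hN
    obtain ⟨ν, hν⟩ := hq.exists_sub_mem_jacobson hnf s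
    obtain ⟨M, hM, hsM⟩ := exists_max_ideal_of_mem_nonunits hs
    have h2 := M.sub_mem hsM (hν M hM)
    rw [sub_sub_cancel, algebraMap_mem_iff_mem_maximalIdeal hM,
      ← algebraMap_mem_iff_mem_maximalIdeal hN] at h2
    simpa using N.add_mem (hν N hN) h2
  refine IsLocalRing.of_nonunits_add fun s t hs ht ↦ ?_
  obtain ⟨N, hN, hsN⟩ := exists_max_ideal_of_mem_nonunits hs
  intro hu
  exact hN.ne_top (N.eq_top_of_isUnit_mem (N.add_mem hsN (h1 t ht N hN)) hu)

theorem dvd_total_of_gcd [IsLocalRing S]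
    (hgcd : ∀ s t : S, ∃ l m : S, l * s + m * t ∣ s ∧ l * s + m * t ∣ t)
    (s t : S) : s ∣ t ∨ t ∣ s := by
  obtain ⟨l, m, ⟨a, ha⟩, b, hb⟩ := hgcd s t
  rcases eq_or_ne (l * s + m * t) 0 with h0 | h0
  · left
    rw [hb, h0, zero_mul]
    exact dvd_zero _
  have h1 : l * a + m * b = 1 := by
    apply mul_left_cancel₀ h0
    linear_combination -l * ha - m * hb
  rcases IsLocalRing.isUnit_or_isUnit_of_add_one h1 with h | h
  · left
    have h2 := isUnit_of_mul_isUnit_right h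
    rw [hb]
    refine dvd_trans ?_ (dvd_mul_right _ b)
    rw [← h2.dvd_mul_right, ← ha]
  · right
    have h2 := isUnit_of_mul_isUnit_right h
    rw [ha]
    refine dvd_trans ?_ (dvd_mul_right _ a)
    rw [← h2.dvd_mul_right, ← hb]

end

section

variable {R S : Type*} [CommRing R] [IsLocalRing R] [CommRing S] [IsDomain S] [Algebra R S]
  [IsLocalRing S]

/-- An element `z` with `m ^ 2 ⊆ z m` has the smallest value among the elements of `m`. -/
theorem algebraMap_dvd_of_sq_le [FaithfulSMul R S] [Ring.DimensionLEOne S]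
    (htot : ∀ s t : S, s ∣ t ∨ t ∣ s) {z : R} (hz0 : z ≠ 0)
    (hsq : ∀ a ∈ IsLocalRing.maximalIdeal R, ∀ b ∈ IsLocalRing.maximalIdeal R,
      ∃ c ∈ IsLocalRing.maximalIdeal R, a * b = z * c) {y : R}
    (hy : y ∈ IsLocalRing.maximalIdeal R) : algebraMap R S z ∣ algebraMap R S y := by
  have hinj := FaithfulSMul.algebraMap_injective R S
  have hz0' : algebraMap R S z ≠ 0 := (map_ne_zero_iff _ hinj).mpr hz0
  by_contra hcon
  obtain ⟨w, hw⟩ := (htot _ _).resolve_left hcon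
  have hy0 : algebraMap R S y ≠ 0 := fun h ↦ hcon (h ▸ dvd_zero _)
  have hwu : ¬ IsUnit w := fun h ↦ hcon (by rw [hw, h.mul_right_dvd])
  -- With `z = yw`, the relation `c * y = z * c'` cancels to `c = w * c'`. Iterating makes `y`
  -- divisible by every power of the nonunit `w`, which dimension one forbids.
  have key : ∀ n, ∃ c ∈ IsLocalRing.maximalIdeal R,
      algebraMap R S y = w ^ n * algebraMap R S c := by
    intro n
    induction n with
    | zero => exact ⟨y, hy, by simp⟩
    | succ n ih =>
      obtain ⟨c, hc, h1⟩ := ih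
      obtain ⟨c', hc', h2⟩ := hsq c hc y hy
      refine ⟨c', hc', ?_⟩
      have h3 : algebraMap R S c = w * algebraMap R S c' := by
        apply mul_right_cancel₀ hy0
        rw [← map_mul, h2, map_mul, hw]
        ring
      rw [h1, h3]
      ring
  obtain ⟨k, t, hk⟩ := exists_dvd_pow_of_dimensionLEOne hy0 hwu
  obtain ⟨c, -, hc⟩ := key (k + 1)
  apply hwu
  have hwk : w ^ k ≠ 0 := by
    intro h
    rw [pow_succ, h] at hc
    simp at hc
    exact hy0 (by simpa using hc)
  refine IsUnit.of_mul_eq_one (algebraMap R S c * t) ?_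
  apply mul_left_cancel₀ hwk
  rw [mul_one]
  conv_rhs => rw [hk, hc]
  ring

/-- If `S ≠ R + z S`, then `R` has a nonzero conductor in `S`. -/
theorem IsQuadraticAlgebra.exists_conductor [IsDomain R] [FaithfulSMul R S]
    [Algebra.IsIntegral R S] (hq : IsQuadraticAlgebra R S)
    (hres : ∀ s : S, ∃ r : R, ¬ IsUnit (s - algebraMap R S r))
    (htot : ∀ s t : S, s ∣ t ∨ t ∣ s)
    (hden : ∀ s : S, ∃ d r : R, d ≠ 0 ∧ algebraMap R S d * s = algebraMap R S r)
    {z : R} (hz0 : z ≠ 0)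
    (hsq : ∀ a ∈ IsLocalRing.maximalIdeal R, ∀ b ∈ IsLocalRing.maximalIdeal R,
      ∃ c ∈ IsLocalRing.maximalIdeal R, a * b = z * c)
    (hdvd : ∀ y ∈ IsLocalRing.maximalIdeal R, algebraMap R S z ∣ algebraMap R S y)
    {s : S} (hs : ¬ IsUnit s)
    (hsz : ∀ (r : R) (t : S), s ≠ algebraMap R S r + algebraMap R S z * t) :
    ∃ c : R, c ≠ 0 ∧ ∀ t : S, ∃ r : R, algebraMap R S c * t = algebraMap R S r := by
  have hinj := FaithfulSMul.algebraMap_injective R S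
  have hz0' : algebraMap R S z ≠ 0 := (map_ne_zero_iff _ hinj).mpr hz0
  have hmax : ∀ {r : R}, r ∈ IsLocalRing.maximalIdeal R ↔ ¬ IsUnit (algebraMap R S r) := by
    intro r
    rw [← algebraMap_mem_iff_mem_maximalIdeal (IsLocalRing.maximalIdeal.isMaximal S)]
    rfl
  have hJ : ∀ {t : S}, ¬ IsUnit t → ∀ N : Ideal S, N.IsMaximal → t ∈ N := fun ht N hN ↦ by
    rw [IsLocalRing.eq_maximalIdeal hN]
    exact ht
  -- Here `z = sx`, and `x` is a nonunit because `s ∉ zS`. The aim is that each nonunit `t` has `t ∈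
  -- R[s]` or `zt ∈ R + Rx`; denominators of `s` and `x` then yield a conductor.
  obtain ⟨x, hx⟩ := (htot (algebraMap R S z) s).resolve_left
    (fun ⟨t, ht⟩ ↦ hsz 0 t (by simpa using ht))
  have hs0 : s ≠ 0 := by
    rintro rfl
    exact hz0' (by simpa using hx)
  have hxu : ¬ IsUnit x := by
    intro h
    obtain ⟨v, hv⟩ := h.exists_left_inv
    exact hsz 0 v (by rw [hx]; linear_combination (-s) * hv - map_zero (algebraMap R S))
  obtain ⟨a, ha, b, hb, hxx⟩ := hq.sq_eq_of_mem_jacobson (hJ hxu)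
  obtain ⟨d₁, r₁, hd₁, hdr₁⟩ := hden x
  obtain ⟨d₂, r₂, hd₂, hdr₂⟩ := hden s
  have key : ∀ t : S, ¬ IsUnit t → t ∈ Algebra.adjoin R {s} ∨
      ∃ ρ σ : R, algebraMap R S z * t = algebraMap R S ρ + algebraMap R S σ * x := by
    intro t ht
    obtain ⟨l, μ, ν, hst⟩ := hq s t
    by_cases hν : ν ∈ IsLocalRing.maximalIdeal R
    swap
    · left
      refine hq.mem_of_isUnit_of_mul_mem (u := s - algebraMap R S ν) ?_
        (sub_mem (Algebra.self_mem_adjoin_singleton R s) (Subalgebra.algebraMap_mem _ _))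
        (hq.mem_adjoin_iff.mpr ⟨l, μ, by linear_combination hst⟩)
      by_contra h
      apply hν
      have h1 := Ideal.sub_mem _ (hJ hs _ (IsLocalRing.maximalIdeal.isMaximal S)) (hJ h _ inferInstance)
      rw [sub_sub_cancel] at h1
      exact hmax.mpr h1
    right
    have hl : l ∈ IsLocalRing.maximalIdeal R := by
      rw [← algebraMap_mem_iff_mem_maximalIdeal (IsLocalRing.maximalIdeal.isMaximal S)]
      have h1 : algebraMap R S l = (t - algebraMap R S μ) * s - algebraMap R S ν * t := by
        linear_combination -hst
      rw [h1]
      exact Ideal.sub_mem _ (Ideal.mul_mem_left _ _ hs) (Ideal.mul_mem_left _ _ ht)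
    have hδ : l + μ * ν ∈ IsLocalRing.maximalIdeal R :=
      Ideal.add_mem _ hl (Ideal.mul_mem_left _ _ hν)
    obtain ⟨ν', hν'⟩ := hdvd ν hν
    obtain ⟨δ', hδ'⟩ := hdvd _ hδ
    obtain ⟨b₁, hb₁, hb₁'⟩ := hsq b hb ν hν
    obtain ⟨a₁, ha₁, ha₁'⟩ := hsq a ha ν hν
    obtain ⟨a₂, ha₂, ha₂'⟩ := hsq a₁ ha₁ ν hν
    obtain ⟨e, he, he'⟩ := hsq a₁ ha₁ _ hδ
    have hb₁S : algebraMap R S b * ν' = algebraMap R S b₁ := by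
      apply mul_left_cancel₀ hz0'
      rw [← map_mul, ← hb₁', map_mul, hν']
      ring
    have ha₁S : algebraMap R S a * ν' = algebraMap R S a₁ := by
      apply mul_left_cancel₀ hz0'
      rw [← map_mul, ← ha₁', map_mul, hν']
      ring
    have ha₂S : algebraMap R S a₁ * ν' = algebraMap R S a₂ := by
      apply mul_left_cancel₀ hz0'
      rw [← map_mul, ← ha₂', map_mul, hν']
      ring
    have heS : algebraMap R S a₁ * δ' = algebraMap R S e := by
      apply mul_left_cancel₀ hz0'
      rw [← map_mul, ← he', map_mul, hδ']
      ring
    -- This is `(s - ν)(t - μ) = l + μν` divided by `s`, with `ν = zν'`, `l + μν = zδ'` and `z =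
    -- sx`.
    have h1 : (1 - x * ν') * (t - algebraMap R S μ) = x * δ' := by
      apply mul_left_cancel₀ hs0
      rw [map_add, map_mul] at hδ'
      linear_combination hst + (t - algebraMap R S μ) * hν' + hδ' +
        (δ' + ν' * (t - algebraMap R S μ)) * hx
    have hu : IsUnit (1 - b₁ - a₂) := by
      rw [← IsLocalRing.notMem_maximalIdeal]
      intro h
      apply (Ideal.ne_top_iff_one _).mp (IsLocalRing.maximalIdeal.isMaximal R).ne_top
      have h6 := Ideal.add_mem _ h (Ideal.add_mem _ hb₁ ha₂)
      rwa [show 1 - b₁ - a₂ + (b₁ + a₂) = 1 by ring] at h6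
    obtain ⟨v, hv⟩ := hu.exists_left_inv
    have hv' := congrArg (algebraMap R S) hv
    simp only [map_mul, map_sub, map_one] at hv'
    -- Multiply `h1` by `1 - bν' + xν'`, the conjugate of `1 - xν'` for `x² = a + bx`. The norm `1 -
    -- bν' - aν'²` lies in `R` and is a unit there.
    have h2 : (1 - algebraMap R S b₁ - algebraMap R S a₂) * (t - algebraMap R S μ) =
        x * δ' + algebraMap R S e := by
      rw [← heS, ← ha₂S, ← ha₁S, ← hb₁S]
      linear_combination (1 - algebraMap R S b * ν' + x * ν') * h1 +
        (ν' ^ 2 * (t - algebraMap R S μ) + ν' * δ') * hxx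
    refine ⟨z * μ + v * z * e, v * (l + μ * ν), ?_⟩
    simp only [map_mul, map_add] at hδ' ⊢
    linear_combination algebraMap R S v * algebraMap R S z * h2 -
      algebraMap R S z * (t - algebraMap R S μ) * hv' - algebraMap R S v * x * hδ'
  refine ⟨z * d₁ * d₂, mul_ne_zero (mul_ne_zero hz0 hd₁) hd₂, fun t ↦ ?_⟩
  obtain ⟨r, hr⟩ := hres t
  rcases key _ hr with h | ⟨ρ, σ, h⟩
  · obtain ⟨ρ, σ, h⟩ := hq.mem_adjoin_iff.mp h
    refine ⟨z * d₁ * (d₂ * r + d₂ * ρ + σ * r₂), ?_⟩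
    simp only [map_mul, map_add]
    linear_combination (algebraMap R S z * algebraMap R S d₁ * algebraMap R S d₂) * h +
      (algebraMap R S z * algebraMap R S d₁ * algebraMap R S σ) * hdr₂
  · refine ⟨d₂ * (z * d₁ * r + d₁ * ρ + σ * r₁), ?_⟩
    simp only [map_mul, map_add]
    linear_combination (algebraMap R S d₂ * algebraMap R S d₁) * h +
      (algebraMap R S d₂ * algebraMap R S σ) * hdr₁

/-- A local valuation ring with trivial residue extension and a nonzero conductor is finite. -/
theorem finite_of_conductor [IsDomain R] [FaithfulSMul R S] [Algebra.IsIntegral R S]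
    [Ring.DimensionLEOne S] (hm : IsLocalRing.maximalIdeal R ≠ ⊥)
    (hsq : ∀ I : Ideal R, I ≠ ⊥ → I.HasPrincipalSquare)
    (hres : ∀ s : S, ∃ r : R, ¬ IsUnit (s - algebraMap R S r))
    (htot : ∀ s t : S, s ∣ t ∨ t ∣ s) {c : R} (hc0 : c ≠ 0)
    (hc : ∀ t : S, ∃ r : R, algebraMap R S c * t = algebraMap R S r) : Module.Finite R S := by
  have hinj := FaithfulSMul.algebraMap_injective R S
  have hc0' : algebraMap R S c ≠ 0 := (map_ne_zero_iff _ hinj).mpr hc0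
  -- Since `cS ⊆ R`, this is `cJ` for the maximal ideal `J` of `S`. Writing its principal square
  -- with `y = cπ` gives `J² = πJ`, whence `J = πS`.
  let I : Ideal R :=
    { carrier := {r | ∃ j ∈ IsLocalRing.maximalIdeal S, algebraMap R S r = algebraMap R S c * j}
      zero_mem' := ⟨0, zero_mem _, by simp⟩
      add_mem' := by
        rintro r r' ⟨j, hj, h⟩ ⟨j', hj', h'⟩
        exact ⟨j + j', add_mem hj hj', by rw [map_add, h, h', mul_add]⟩
      smul_mem' := by
        rintro r r' ⟨j, hj, h⟩
        exact ⟨algebraMap R S r * j, Ideal.mul_mem_left _ _ hj, by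
          rw [smul_eq_mul, map_mul, h, mul_left_comm]⟩ }
  have hI : I ≠ ⊥ := by
    obtain ⟨a, ha, ha0⟩ := Submodule.exists_mem_ne_zero_of_ne_bot hm
    intro h
    have h1 : c * a ∈ I := ⟨algebraMap R S a,
      (algebraMap_mem_iff_mem_maximalIdeal (IsLocalRing.maximalIdeal.isMaximal S)).mpr ha,
      map_mul _ _ _⟩
    rw [h, Ideal.mem_bot] at h1
    exact mul_ne_zero hc0 ha0 h1
  obtain ⟨y, ⟨π, hπ, hy⟩, hy0, hyI⟩ := (hsq I hI).exists_ne_zero hI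
  have hπ0 : π ≠ 0 := by
    rintro rfl
    exact hy0 (hinj (by simpa using hy))
  have hsqJ : ∀ i ∈ IsLocalRing.maximalIdeal S, ∀ j ∈ IsLocalRing.maximalIdeal S,
      ∃ k ∈ IsLocalRing.maximalIdeal S, i * j = π * k := by
    intro i hi j hj
    obtain ⟨r, hr⟩ := hc i
    obtain ⟨r', hr'⟩ := hc j
    obtain ⟨q, ⟨k, hk, hq⟩, h⟩ := hyI r ⟨i, hi, hr.symm⟩ r' ⟨j, hj, hr'.symm⟩
    refine ⟨k, hk, mul_left_cancel₀ (mul_ne_zero hc0' hc0') ?_⟩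
    have h2 := congrArg (algebraMap R S) h
    rw [map_mul, map_mul, ← hr, ← hr', hy, hq] at h2
    linear_combination h2
  have hdvd : ∀ j : S, ¬ IsUnit j → π ∣ j := by
    intro j hj
    rcases htot π j with h | ⟨w, hw⟩
    · exact h
    by_cases hwu : IsUnit w
    · rw [hw, hwu.mul_right_dvd]
    obtain ⟨k, hk, h⟩ := hsqJ j hj w hwu
    have hk1 : k = 1 := by
      apply mul_left_cancel₀ hπ0
      rw [← h, mul_one, hw]
    exact absurd (hk1 ▸ hk) ((Ideal.ne_top_iff_one _).mp
      (IsLocalRing.maximalIdeal.isMaximal S).ne_top)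
  obtain ⟨n, e, hn⟩ := exists_dvd_pow_of_dimensionLEOne hc0' hπ
  have key : ∀ k (s : S), ∃ b ∈ Algebra.adjoin R {π}, ∃ t, s = b + π ^ k * t := by
    intro k
    induction k with
    | zero => exact fun s ↦ ⟨0, zero_mem _, s, by simp⟩
    | succ k ih =>
      intro s
      obtain ⟨b, hb, t, rfl⟩ := ih s
      obtain ⟨r, hr⟩ := hres t
      obtain ⟨t', ht'⟩ := hdvd _ hr
      refine ⟨b + π ^ k * algebraMap R S r, add_mem hb (mul_mem
        (pow_mem (Algebra.self_mem_adjoin_singleton R π) k) (Subalgebra.algebraMap_mem _ r)),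
        t', ?_⟩
      linear_combination π ^ k * ht'
  by_contra hnf
  -- `S = R[π] + π^n S`, and `π^n S ⊆ cS ⊆ R` for the chosen `n`; so `S = R[π]`.
  refine Algebra.IsIntegral.adjoin_ne_top (R := R) hnf (Set.finite_singleton π) ?_
  rw [eq_top_iff]
  rintro s -
  obtain ⟨b, hb, t, rfl⟩ := key n s
  obtain ⟨r, hr⟩ := hc (e * t)
  rw [hn, mul_assoc, hr]
  exact add_mem hb (Subalgebra.algebraMap_mem _ r)

end

/-- A local domain of dimension one whose nonzero ideals have principal squares and which has no
finite normalization has an element `π` that is a uniformizer of the normalization, and the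
normalization has trivial residue extension modulo `π`. -/
theorem exists_uniformizer {R S : Type*} [CommRing R] [IsDomain R] [IsLocalRing R] [CommRing S]
    [IsDomain S] [Algebra R S] [FaithfulSMul R S] [Algebra.IsIntegral R S]
    (hR : ringKrullDim R = 1) (hsq : ∀ I : Ideal R, I ≠ ⊥ → I.HasPrincipalSquare)
    (hq : IsQuadraticAlgebra R S)
    (hgcd : ∀ s t : S, ∃ l m : S, l * s + m * t ∣ s ∧ l * s + m * t ∣ t)
    (hden : ∀ s : S, ∃ d r : R, d ≠ 0 ∧ algebraMap R S d * s = algebraMap R S r)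
    (hnf : ¬ Module.Finite R S) :
    ∃ π ∈ IsLocalRing.maximalIdeal R, π ≠ 0 ∧
      (∀ s : S, ∃ (r : R) (t : S), s = algebraMap R S r + algebraMap R S π * t) ∧
      ∀ s : S, ¬ IsUnit s → algebraMap R S π ∣ s := by
  have := dimensionLEOne_of_ringKrullDim_eq_one hR
  have : Ring.DimensionLEOne S := Ring.DimensionLEOne.of_isIntegral R S
  have := hq.isLocalRing hnf
  have hm : IsLocalRing.maximalIdeal R ≠ ⊥ := fun h ↦
    (ringKrullDim_eq_one_iff_of_isLocalRing_isDomain.mp hR).1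
      (IsLocalRing.isField_iff_maximalIdeal_eq.mpr h)
  have htot := dvd_total_of_gcd hgcd
  have hres : ∀ s : S, ∃ r : R, ¬ IsUnit (s - algebraMap R S r) := fun s ↦ by
    obtain ⟨r, hr⟩ := hq.exists_sub_mem_jacobson hnf s
    exact ⟨r, hr _ (IsLocalRing.maximalIdeal.isMaximal S)⟩
  obtain ⟨π, hπ, hπ0, hπsq⟩ := (hsq _ hm).exists_ne_zero hm
  have hdvd : ∀ y ∈ IsLocalRing.maximalIdeal R, algebraMap R S π ∣ algebraMap R S y :=
    fun y hy ↦ algebraMap_dvd_of_sq_le htot hπ0 hπsq hy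
  have hsum : ∀ s : S, ∃ (r : R) (t : S), s = algebraMap R S r + algebraMap R S π * t := by
    intro s
    by_contra! hcon
    obtain ⟨r, hr⟩ := hres s
    obtain ⟨c, hc0, hc⟩ := hq.exists_conductor hres htot hden hπ0 hπsq hdvd hr
      (fun r' t h ↦ hcon (r + r') t (by rw [map_add]; linear_combination h))
    exact hnf (finite_of_conductor hm hsq hres htot hc0 hc)
  refine ⟨π, hπ, hπ0, hsum, fun s hs ↦ ?_⟩
  obtain ⟨r, t, rfl⟩ := hsum s
  refine dvd_add (hdvd r ?_) (dvd_mul_right _ t)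
  have hN := IsLocalRing.maximalIdeal.isMaximal S
  rw [← algebraMap_mem_iff_mem_maximalIdeal hN]
  have h1 := Ideal.sub_mem (IsLocalRing.maximalIdeal S) hs (Ideal.mul_mem_right t _
    ((algebraMap_mem_iff_mem_maximalIdeal hN).mpr hπ))
  rwa [add_sub_cancel_right] at h1

/-! ### Principal adic completions, and from the prime `P` to bad stability -/

/-- `T` is a completion of `R` with respect to the powers of `π`. -/
structure IsPrincipalAdicCompletion (R T : Type*) [CommRing R] [CommRing T] [Algebra R T]
    (π : R) : Prop where
  exists_dvd_sub : ∀ (n : ℕ) (x : T), ∃ a : R, algebraMap R T (π ^ n) ∣ x - algebraMap R T a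
  dvd_of_algebraMap_dvd : ∀ (n : ℕ) (a : R),
    algebraMap R T (π ^ n) ∣ algebraMap R T a → π ^ n ∣ a
  eq_zero_of_forall_dvd : ∀ x : T, (∀ n : ℕ, algebraMap R T (π ^ n) ∣ x) → x = 0
  exists_limit : ∀ f : ℕ → R, (∀ n, π ^ n ∣ f (n + 1) - f n) →
    ∃ x : T, ∀ n, algebraMap R T (π ^ n) ∣ x - algebraMap R T (f n)

namespace IsPrincipalAdicCompletion

variable {R T : Type*} [CommRing R] [CommRing T] [Algebra R T] {π : R}

theorem dvd_sub_of_dvd_sub (h : IsPrincipalAdicCompletion R T π) {n : ℕ} {x : T} {a b : R}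
    (ha : algebraMap R T (π ^ n) ∣ x - algebraMap R T a)
    (hb : algebraMap R T (π ^ n) ∣ x - algebraMap R T b) : π ^ n ∣ a - b := by
  apply h.dvd_of_algebraMap_dvd
  have h1 := dvd_sub hb ha
  rwa [sub_sub_sub_cancel_left, ← map_sub] at h1

theorem injective [IsDomain R] (h : IsPrincipalAdicCompletion R T π)
    (hdim : ∀ x : R, x ≠ 0 → ∃ n, x ∣ π ^ n) (hπ0 : π ≠ 0) (hπ : ¬ IsUnit π) :
    Function.Injective (algebraMap R T) := by
  rw [injective_iff_map_eq_zero]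
  intro r hr
  by_contra hr0
  obtain ⟨n, c, hc⟩ := hdim r hr0
  obtain ⟨d, hd⟩ := h.dvd_of_algebraMap_dvd (n + 1) r (hr ▸ dvd_zero _)
  refine hπ (IsUnit.of_mul_eq_one (d * c) (mul_left_cancel₀ (pow_ne_zero n hπ0) ?_))
  rw [mul_one]
  conv_rhs => rw [hc, hd]
  ring

/-- The ideal contains some `π^n`, and modulo `π^n` an element of `IT` is approximated by an element
of `I`. -/
theorem mem_of_algebraMap_mem_map (h : IsPrincipalAdicCompletion R T π)
    (hdim : ∀ x : R, x ≠ 0 → ∃ n, x ∣ π ^ n) {I : Ideal R} (hI : I ≠ ⊥) {a : R}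
    (ha : algebraMap R T a ∈ I.map (algebraMap R T)) : a ∈ I := by
  obtain ⟨b, hb, hb0⟩ := Submodule.exists_mem_ne_zero_of_ne_bot hI
  obtain ⟨n, hn⟩ := hdim b hb0
  have hnI : π ^ n ∈ I := I.mem_of_dvd hn hb
  have key : ∀ t ∈ I.map (algebraMap R T), ∃ i ∈ I,
      algebraMap R T (π ^ n) ∣ t - algebraMap R T i := by
    intro t ht
    induction ht using Submodule.span_induction with
    | mem t ht =>
      obtain ⟨i, hi, rfl⟩ := ht
      exact ⟨i, hi, by simp⟩
    | zero => exact ⟨0, I.zero_mem, by simp⟩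
    | add s t _ _ hs ht =>
      obtain ⟨i, hi, h1⟩ := hs
      obtain ⟨j, hj, h2⟩ := ht
      refine ⟨i + j, I.add_mem hi hj, ?_⟩
      rw [map_add, add_sub_add_comm]
      exact dvd_add h1 h2
    | smul r t _ ht =>
      obtain ⟨i, hi, h1⟩ := ht
      obtain ⟨c, hc⟩ := h.exists_dvd_sub n r
      refine ⟨c * i, I.mul_mem_left _ hi, ?_⟩
      have h2 : r • t - algebraMap R T (c * i) = r * (t - algebraMap R T i) +
          (r - algebraMap R T c) * algebraMap R T i := by
        rw [smul_eq_mul, map_mul]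
        ring
      rw [h2]
      exact dvd_add (h1.mul_left _) (hc.mul_right _)
  obtain ⟨i, hi, h1⟩ := key _ ha
  rw [← map_sub] at h1
  have h2 := I.add_mem (I.mem_of_dvd (h.dvd_of_algebraMap_dvd n _ h1) hnI) hi
  rwa [sub_add_cancel] at h2

theorem isUnit_of_dvd_sub [IsLocalRing R] (h : IsPrincipalAdicCompletion R T π)
    (hπ : π ∈ IsLocalRing.maximalIdeal R) {y : T} {c : R} (hc : IsUnit c)
    (hy : algebraMap R T π ∣ y - algebraMap R T c) : IsUnit y := by
  -- The shift to `n + 1` keeps every approximant congruent to `c` modulo `π`, hence a unit; the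
  -- inverses then converge to an inverse of `y`.
  choose f hf using fun n ↦ h.exists_dvd_sub (n + 1) y
  have hunit : ∀ n, IsUnit (f n) := by
    intro n
    have h1 : algebraMap R T (π ^ 1) ∣ y - algebraMap R T (f n) :=
      (map_dvd _ (pow_dvd_pow π (by omega))).trans (hf n)
    have h2 := h.dvd_sub_of_dvd_sub (n := 1) (by rwa [pow_one]) h1
    rw [pow_one] at h2
    rw [← IsLocalRing.notMem_maximalIdeal] at hc ⊢
    intro h3
    have h4 := Ideal.add_mem _ (Ideal.mem_of_dvd _ h2 hπ) h3
    rw [sub_add_cancel] at h4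
    exact hc h4
  choose v hv using fun n ↦ (hunit n).exists_right_inv
  obtain ⟨w, hw⟩ := h.exists_limit v (fun n ↦ by
    have h1 : algebraMap R T (π ^ (n + 1)) ∣ y - algebraMap R T (f (n + 1)) :=
      (map_dvd _ (pow_dvd_pow π (by omega))).trans (hf (n + 1))
    have h2 := (pow_dvd_pow π n.le_succ).trans (h.dvd_sub_of_dvd_sub (hf n) h1)
    have h3 : v (n + 1) - v n = v n * v (n + 1) * (f n - f (n + 1)) := by
      linear_combination v n * hv (n + 1) - v (n + 1) * hv n
    rw [h3]
    exact h2.mul_left _)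
  refine IsUnit.of_mul_eq_one w ?_
  rw [← sub_eq_zero]
  refine h.eq_zero_of_forall_dvd _ fun n ↦ ?_
  have h1 := congrArg (algebraMap R T) (hv n)
  rw [map_mul, map_one] at h1
  have h2 : y * w - 1 = y * (w - algebraMap R T (v n)) +
      (y - algebraMap R T (f n)) * algebraMap R T (v n) := by
    linear_combination h1
  rw [h2]
  exact dvd_add ((hw n).mul_left _)
    (((map_dvd _ (pow_dvd_pow π n.le_succ)).trans (hf n)).mul_right _)

section

variable {P : Ideal T}

theorem exists_mul_eq_of_dvd [IsDomain R] (h : IsPrincipalAdicCompletion R T π)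
    (hdim : ∀ x : R, x ≠ 0 → ∃ n, x ∣ π ^ n) (hP : P ^ 2 = ⊥) {a a' b : R} (hb : b ≠ 0)
    (ha : Ideal.Quotient.mk P (algebraMap R T b) ∣ Ideal.Quotient.mk P (algebraMap R T a))
    (ha' : Ideal.Quotient.mk P (algebraMap R T b) ∣ Ideal.Quotient.mk P (algebraMap R T a')) :
    ∃ α β γ : R, a * a' = α * (b * b) + β * (a * b) + γ * (a' * b) := by
  obtain ⟨t, ht⟩ := ha
  obtain ⟨t', ht'⟩ := ha'
  obtain ⟨t, rfl⟩ := Ideal.Quotient.mk_surjective t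
  obtain ⟨t', rfl⟩ := Ideal.Quotient.mk_surjective t'
  rw [← map_mul, Ideal.Quotient.eq] at ht ht'
  have h0 : (algebraMap R T a - algebraMap R T b * t) *
      (algebraMap R T a' - algebraMap R T b * t') = 0 := by
    rw [← Ideal.mem_bot, ← hP, sq]
    exact Ideal.mul_mem_mul ht ht'
  let I : Ideal R := Ideal.span {b * b, a * b, a' * b}
  have h1 : b * b ∈ I := Ideal.subset_span (by simp)
  have h2 : a * b ∈ I := Ideal.subset_span (by simp)
  have h3 : a' * b ∈ I := Ideal.subset_span (by simp)
  have hI : I ≠ ⊥ := fun h ↦ mul_ne_zero hb hb (by rwa [h, Ideal.mem_bot] at h1)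
  have h4 : a * a' ∈ I := by
    apply h.mem_of_algebraMap_mem_map hdim hI
    have h5 : algebraMap R T (a * a') = t' * algebraMap R T (a * b) +
        t * algebraMap R T (a' * b) - t * t' * algebraMap R T (b * b) := by
      simp only [map_mul]
      linear_combination h0
    rw [h5]
    exact sub_mem (add_mem (Ideal.mul_mem_left _ _ (Ideal.mem_map_of_mem _ h2))
      (Ideal.mul_mem_left _ _ (Ideal.mem_map_of_mem _ h3)))
      (Ideal.mul_mem_left _ _ (Ideal.mem_map_of_mem _ h1))
  obtain ⟨α, β, γ, h⟩ := Submodule.mem_span_triple.mp h4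
  exact ⟨α, β, γ, h.symm⟩

theorem isIntegral_div [IsDomain R] (h : IsPrincipalAdicCompletion R T π)
    (hdim : ∀ x : R, x ≠ 0 → ∃ n, x ∣ π ^ n) (hP : P ^ 2 = ⊥) {a b : R} (hb : b ≠ 0)
    (ha : Ideal.Quotient.mk P (algebraMap R T b) ∣ Ideal.Quotient.mk P (algebraMap R T a)) :
    IsIntegral R (algebraMap R (FractionRing R) a / algebraMap R (FractionRing R) b) := by
  obtain ⟨α, β, γ, h1⟩ := h.exists_mul_eq_of_dvd hdim hP hb ha ha
  have hb' : algebraMap R (FractionRing R) b ≠ 0 := by simpa using hb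
  have h2 := congrArg (algebraMap R (FractionRing R)) h1
  simp only [map_mul, map_add] at h2
  have h3 := div_mul_cancel₀ (algebraMap R (FractionRing R) a) hb'
  generalize algebraMap R (FractionRing R) a / algebraMap R (FractionRing R) b = x at h3 ⊢
  have h4 : x ^ 2 - ((algebraMap R (FractionRing R) β + algebraMap R (FractionRing R) γ) * x +
      algebraMap R (FractionRing R) α) = 0 := by
    apply mul_left_cancel₀ (mul_ne_zero hb' hb')
    rw [← h3] at h2
    linear_combination h2
  refine ⟨Polynomial.X ^ 2 - (Polynomial.C (β + γ) * Polynomial.X + Polynomial.C α),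
    Polynomial.monic_X_pow_sub Polynomial.degree_linear_lt, ?_⟩
  rw [Polynomial.eval₂_sub, Polynomial.eval₂_pow, Polynomial.eval₂_X, Polynomial.eval₂_add,
    Polynomial.eval₂_mul, Polynomial.eval₂_C, Polynomial.eval₂_C, Polynomial.eval₂_X, map_add]
  exact h4

/-- Let `c` be a common denominator of the normalization, with `c ∣ π^n`. Approximating the quotient
in `T` modulo `π^n` by `d ∈ R` makes `a - bd` divisible by `bc` in `T/P`, so `(a - bd)/(bc)` is
integral and `c` times it is in `R`. -/
theorem dvd_of_finite [IsDomain R] (h : IsPrincipalAdicCompletion R T π)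
    (hdim : ∀ x : R, x ≠ 0 → ∃ n, x ∣ π ^ n) (hP : P ^ 2 = ⊥)
    (hfin : HasFiniteNormalization R) {a b : R} (hb : b ≠ 0)
    (ha : Ideal.Quotient.mk P (algebraMap R T b) ∣ Ideal.Quotient.mk P (algebraMap R T a)) :
    b ∣ a := by
  obtain ⟨c, hc, hcI⟩ := FractionalIdeal.isFractional_of_fg (S := nonZeroDivisors R)
    (I := Subalgebra.toSubmodule (integralClosure R (FractionRing R)))
    (Module.Finite.iff_fg.mp hfin)
  have hc0 := nonZeroDivisors.ne_zero hc
  obtain ⟨n, e, hn⟩ := hdim c hc0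
  obtain ⟨t, ht⟩ := ha
  obtain ⟨t, rfl⟩ := Ideal.Quotient.mk_surjective t
  obtain ⟨d, t', hd⟩ := h.exists_dvd_sub n t
  have h1 : Ideal.Quotient.mk P (algebraMap R T (b * c)) ∣
      Ideal.Quotient.mk P (algebraMap R T (a - b * d)) := by
    refine ⟨Ideal.Quotient.mk P (algebraMap R T e * t'), ?_⟩
    have h2 : t = algebraMap R T d + algebraMap R T c * algebraMap R T e * t' := by
      rw [← map_mul, ← hn, ← hd]
      ring
    simp only [map_mul, map_sub, ht]
    rw [h2]
    simp only [map_mul, map_add]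
    ring
  obtain ⟨r, hr⟩ := hcI _ (h.isIntegral_div hdim hP (mul_ne_zero hb hc0) h1)
  have hb' : algebraMap R (FractionRing R) b ≠ 0 := by simpa using hb
  have hc' : algebraMap R (FractionRing R) c ≠ 0 := by simpa using hc0
  refine ⟨d + r, IsFractionRing.injective R (FractionRing R) ?_⟩
  rw [Algebra.smul_def, map_mul, map_sub, map_mul] at hr
  rw [map_mul, map_add, hr]
  field_simp
  ring

theorem isBadStableDomain {R : Type*} [CommRing R] [Algebra R T] {π : R} [IsDomain R]
    [IsLocalRing R] (hR : ringKrullDim R = 1)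
    (h : IsPrincipalAdicCompletion R T π) (hπ : π ∈ IsLocalRing.maximalIdeal R) (hπ0 : π ≠ 0)
    (hT : HasSquareZeroPrimeWithDVRQuotient T) : IsBadStableDomain R := by
  obtain ⟨P, hprime, hP0, hP, hV⟩ := hT
  have hdim : ∀ x : R, x ≠ 0 → ∃ n, x ∣ π ^ n := fun x hx ↦
    exists_dvd_pow_of_ringKrullDim_eq_one hR hx hπ
  have hinj := h.injective hdim hπ0 hπ
  refine ⟨inferInstance, inferInstance, hR, fun I hI ↦ Ideal.HasPrincipalSquare.isStable hI ?_,
    fun hfin ↦ hP0 ?_⟩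
  · let v : R → ℕ∞ := fun r ↦
      IsDiscreteValuationRing.addVal (T ⧸ P) (Ideal.Quotient.mk P (algebraMap R T r))
    obtain ⟨_, ⟨x, hx, rfl⟩, hmin⟩ := wellFounded_lt.has_min (v '' I) ⟨_, 0, I.zero_mem, rfl⟩
    have hdvd : ∀ y ∈ I, Ideal.Quotient.mk P (algebraMap R T x) ∣
        Ideal.Quotient.mk P (algebraMap R T y) := fun y hy ↦ by
      rw [← IsDiscreteValuationRing.addVal_le_iff_dvd]
      exact not_lt.mp (hmin _ ⟨y, hy, rfl⟩)
    have hx0 : x ≠ 0 := by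
      rintro rfl
      obtain ⟨y, hy, hy0⟩ := Submodule.exists_mem_ne_zero_of_ne_bot hI
      have h1 := hdvd y hy
      rw [map_zero, map_zero, zero_dvd_iff, Ideal.Quotient.eq_zero_iff_mem] at h1
      have h2 : algebraMap R T (y * y) = 0 := by
        rw [← Ideal.mem_bot, ← hP, sq, map_mul]
        exact Ideal.mul_mem_mul h1 h1
      exact mul_ne_zero hy0 hy0 ((map_eq_zero_iff _ hinj).mp h2)
    refine ⟨x, hx, fun y hy z hz ↦ ?_⟩
    obtain ⟨α, β, γ, h1⟩ := h.exists_mul_eq_of_dvd hdim hP hx0 (hdvd y hy) (hdvd z hz)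
    exact ⟨α * x + β * y + γ * z, add_mem (add_mem (I.mul_mem_left _ hx) (I.mul_mem_left _ hy))
      (I.mul_mem_left _ hz), by rw [h1]; ring⟩
  · rw [eq_bot_iff]
    intro p hp
    refine h.eq_zero_of_forall_dvd p fun n ↦ ?_
    obtain ⟨a, t, ha⟩ := h.exists_dvd_sub n p
    have h1 : π ^ n ∣ a := h.dvd_of_finite hdim hP hfin (pow_ne_zero n hπ0) ⟨
      Ideal.Quotient.mk P (-t), by
        rw [← map_mul, Ideal.Quotient.eq]
        have h2 : algebraMap R T a - algebraMap R T (π ^ n) * -t = p := by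
          linear_combination -ha
        rwa [h2]⟩
    rw [← sub_add_cancel p (algebraMap R T a)]
    exact dvd_add ⟨t, ha⟩ (map_dvd _ h1)

end

end IsPrincipalAdicCompletion

/-! ### The kernel of completion and its DVR quotient -/

namespace IsPrincipalAdicCompletion

section

variable {R S T : Type*} [CommRing R] [CommRing S] [CommRing T] [Algebra R S] [Algebra R T] {π : R}

/-- The kernel of the map from the `π`-adic completion `T` of `R` to that of `S`. -/
def kernel (S : Type*) [CommRing S] [Algebra R S] (h : IsPrincipalAdicCompletion R T π) :
    Ideal T where
  carrier := {x | ∀ n, ∃ a : R, algebraMap R S (π ^ n) ∣ algebraMap R S a ∧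
    algebraMap R T (π ^ n) ∣ x - algebraMap R T a}
  zero_mem' := fun n ↦ ⟨0, by simp, by simp⟩
  add_mem' := by
    intro x y hx hy n
    obtain ⟨a, ha, hxa⟩ := hx n
    obtain ⟨b, hb, hyb⟩ := hy n
    refine ⟨a + b, by rw [map_add]; exact dvd_add ha hb, ?_⟩
    rw [map_add, add_sub_add_comm]
    exact dvd_add hxa hyb
  smul_mem' := by
    intro t x hx n
    obtain ⟨a, ha, hxa⟩ := hx n
    obtain ⟨c, hc⟩ := h.exists_dvd_sub n t
    refine ⟨c * a, by rw [map_mul]; exact ha.mul_left _, ?_⟩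
    have h1 : t • x - algebraMap R T (c * a) = t * (x - algebraMap R T a) +
        (t - algebraMap R T c) * algebraMap R T a := by
      rw [smul_eq_mul, map_mul]
      ring
    rw [h1]
    exact dvd_add (hxa.mul_left _) (hc.mul_right _)

variable (h : IsPrincipalAdicCompletion R T π)

theorem dvd_of_mem_kernel {x : T} (hx : x ∈ h.kernel S) {n : ℕ} {a : R}
    (ha : algebraMap R T (π ^ n) ∣ x - algebraMap R T a) :
    algebraMap R S (π ^ n) ∣ algebraMap R S a := by
  obtain ⟨b, hb, hxb⟩ := hx n
  have h1 := map_dvd (algebraMap R S) (h.dvd_sub_of_dvd_sub ha hxb)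
  rw [← sub_add_cancel a b, map_add]
  exact dvd_add h1 hb

/-- Approximate by `a = π^n s` and `b = π^n t`. The expansion of `st` turns `ab = π^(2n) st` into
`π^n(απ^n + βa + γb)`, which is divisible by `π^n` already in `R`. -/
theorem kernel_sq [FaithfulSMul R S] (hq : IsQuadraticAlgebra R S) : h.kernel S ^ 2 = ⊥ := by
  rw [eq_bot_iff, sq, Ideal.mul_le]
  intro x hx y hy
  refine h.eq_zero_of_forall_dvd _ fun n ↦ ?_
  obtain ⟨a, ⟨s, hs⟩, hxa⟩ := hx n
  obtain ⟨b, ⟨t, ht⟩, hyb⟩ := hy n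
  obtain ⟨α, β, γ, hst⟩ := hq s t
  have h1 : a * b = π ^ n * (α * π ^ n + β * a + γ * b) := by
    apply FaithfulSMul.algebraMap_injective R S
    rw [map_mul, map_mul, map_add, map_add, map_mul, map_mul, map_mul, hs, ht]
    linear_combination algebraMap R S (π ^ n) ^ 2 * hst
  have h2 : x * y = x * (y - algebraMap R T b) + (x - algebraMap R T a) * algebraMap R T b +
      algebraMap R T (a * b) := by
    rw [map_mul]
    ring
  rw [h2]
  exact dvd_add (dvd_add (hyb.mul_left _) (hxa.mul_right _)) (map_dvd _ ⟨_, h1⟩)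

/-- Elements of `R ∩ π ^ k S` lift to the kernel modulo `π ^ k`. -/
theorem exists_mem_kernel_dvd_sub
    (hsum : ∀ s : S, ∃ (r : R) (t : S), s = algebraMap R S r + algebraMap R S π * t)
    {k : ℕ} {a : R} (ha : algebraMap R S (π ^ k) ∣ algebraMap R S a) :
    ∃ p ∈ h.kernel S, algebraMap R T (π ^ k) ∣ algebraMap R T a - p := by
  -- Writing the quotient of `g` by `π^(k+j)` as `r + πt`, subtracting `π^(k+j) r` gains one power
  -- of `π`. The successive corrections converge in `T`.
  have step : ∀ (j : ℕ) (g : {g : R // algebraMap R S (π ^ (k + j)) ∣ algebraMap R S g}),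
      ∃ g' : {g : R // algebraMap R S (π ^ (k + (j + 1))) ∣ algebraMap R S g},
        π ^ (k + j) ∣ g'.1 - g.1 := by
    rintro j ⟨g, s, hs⟩
    obtain ⟨r, t, rfl⟩ := hsum s
    refine ⟨⟨g - π ^ (k + j) * r, t, ?_⟩, -r, by ring⟩
    rw [map_sub, hs, ← add_assoc, pow_succ, map_mul, map_mul]
    ring
  choose next hnext using step
  let g : ∀ j : ℕ, {g : R // algebraMap R S (π ^ (k + j)) ∣ algebraMap R S g} :=
    fun j ↦ Nat.rec ⟨a, ha⟩ (fun j x ↦ next j x) j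
  have hg : ∀ j, π ^ (k + j) ∣ (g (j + 1)).1 - (g j).1 := fun j ↦ hnext j (g j)
  have hga : ∀ j, π ^ k ∣ (g j).1 - a := by
    intro j
    induction j with
    | zero => simp [g]
    | succ j ih =>
      have h1 := dvd_add ((pow_dvd_pow π (Nat.le_add_right k j)).trans (hg j)) ih
      rwa [sub_add_sub_cancel] at h1
  obtain ⟨p, hp⟩ := h.exists_limit (fun j ↦ (g j).1)
    (fun j ↦ (pow_dvd_pow π (Nat.le_add_left j k)).trans (hg j))
  refine ⟨p, fun n ↦ ⟨(g n).1, ?_, hp n⟩, ?_⟩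
  · exact (map_dvd _ (pow_dvd_pow π (Nat.le_add_left n k))).trans (g n).2
  · have h1 := dvd_add (hp k) (map_dvd (algebraMap R T) (hga k))
    rw [map_sub, sub_add_sub_cancel] at h1
    rwa [dvd_sub_comm]

/-- A fraction `s` has `π^n s ∈ R ∩ π^n S` for some `n`. This element lifts to the kernel modulo
`π^n`, so a zero kernel would make it divisible by `π^n` in `R`, giving `s ∈ R`. -/
theorem kernel_ne_bot [IsDomain S] [FaithfulSMul R S]
    (hsum : ∀ s : S, ∃ (r : R) (t : S), s = algebraMap R S r + algebraMap R S π * t)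
    (hdim : ∀ x : R, x ≠ 0 → ∃ n, x ∣ π ^ n) (hπ0 : π ≠ 0)
    (hden : ∀ s : S, ∃ d r : R, d ≠ 0 ∧ algebraMap R S d * s = algebraMap R S r)
    (hsurj : ¬ Function.Surjective (algebraMap R S)) : h.kernel S ≠ ⊥ := by
  have hinj := FaithfulSMul.algebraMap_injective R S
  have hπ0' : algebraMap R S π ≠ 0 := (map_ne_zero_iff _ hinj).mpr hπ0
  intro hbot
  apply hsurj
  intro s
  obtain ⟨d, r, hd, hdr⟩ := hden s
  obtain ⟨n, e, hn⟩ := hdim d hd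
  have h1 : algebraMap R S (e * r) = algebraMap R S (π ^ n) * s := by
    rw [hn, map_mul, map_mul, ← hdr]
    ring
  obtain ⟨p, hp, hpr⟩ := h.exists_mem_kernel_dvd_sub hsum (Dvd.intro _ h1.symm)
  rw [hbot, Ideal.mem_bot] at hp
  rw [hp, sub_zero] at hpr
  obtain ⟨c, hc⟩ := h.dvd_of_algebraMap_dvd n _ hpr
  refine ⟨c, ?_⟩
  rw [hc, map_mul] at h1
  exact mul_left_cancel₀ (by rw [map_pow]; exact pow_ne_zero n hπ0') h1

theorem pow_notMem_kernel [IsDomain S] [FaithfulSMul R S] (hπ0 : π ≠ 0)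
    (hπS : ¬ IsUnit (algebraMap R S π)) (n : ℕ) :
    algebraMap R T (π ^ n) ∉ h.kernel S := by
  have hπ0' : algebraMap R S π ≠ 0 :=
    (map_ne_zero_iff _ (FaithfulSMul.algebraMap_injective R S)).mpr hπ0
  intro hmem
  have h1 := h.dvd_of_mem_kernel (n := n + 1) (a := π ^ n) hmem (by simp)
  rw [map_pow, map_pow] at h1
  exact hπS (isUnit_of_dvd_one ((mul_dvd_mul_iff_left (pow_ne_zero n hπ0')).mp (by
    rwa [mul_one, ← pow_succ])))

theorem exists_eq_pow_mul_add [IsLocalRing R]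
    (hsum : ∀ s : S, ∃ (r : R) (t : S), s = algebraMap R S r + algebraMap R S π * t)
    (hπ : π ∈ IsLocalRing.maximalIdeal R)
    (hdvd : ∀ r ∈ IsLocalRing.maximalIdeal R, algebraMap R S π ∣ algebraMap R S r)
    {x : T} (hx : x ∉ h.kernel S) :
    ∃ (k : ℕ) (u p : T), IsUnit u ∧ p ∈ h.kernel S ∧ x = algebraMap R T (π ^ k) * u + p := by
  classical
  -- The least such `n` is one more than the value of `x`. At `k = n - 1` an approximant of `x`
  -- lifts to `p` in the kernel, and the cofactor of `π^k` in `x - p` is a unit by the choice of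
  -- `n`.
  have hex : ∃ n, ∃ a : R, algebraMap R T (π ^ n) ∣ x - algebraMap R T a ∧
      ¬ algebraMap R S (π ^ n) ∣ algebraMap R S a := by
    by_contra! hcon
    refine hx fun n ↦ ?_
    obtain ⟨a, ha⟩ := h.exists_dvd_sub n x
    exact ⟨a, hcon n a ha, ha⟩
  obtain ⟨a, ha, hna⟩ := Nat.find_spec hex
  have hn0 : Nat.find hex ≠ 0 := by
    intro h0
    rw [h0] at hna
    simp at hna
  obtain ⟨k, hk⟩ := Nat.exists_eq_succ_of_ne_zero hn0
  have hka : algebraMap R S (π ^ k) ∣ algebraMap R S a := by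
    by_contra hcon
    exact Nat.find_min hex (m := k) (by omega)
      ⟨a, (map_dvd _ (pow_dvd_pow π (by omega))).trans ha, hcon⟩
  rw [hk] at ha hna
  obtain ⟨w, hw⟩ := ha
  obtain ⟨p, hp, y₀, hy₀⟩ := h.exists_mem_kernel_dvd_sub hsum hka
  have hxy : x = algebraMap R T (π ^ k) * (y₀ + algebraMap R T π * w) + p := by
    rw [pow_succ, map_mul] at hw
    linear_combination hw + hy₀
  obtain ⟨c, hc⟩ := h.exists_dvd_sub 1 (y₀ + algebraMap R T π * w)
  rw [pow_one] at hc
  refine ⟨k, _, p, h.isUnit_of_dvd_sub hπ (c := c) ?_ hc, hp, hxy⟩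
  rw [← IsLocalRing.notMem_maximalIdeal]
  intro hcm
  apply hna
  obtain ⟨b, hb⟩ := h.exists_dvd_sub (k + 1) p
  have h1 : algebraMap R T (π ^ (k + 1)) ∣ x - algebraMap R T (π ^ k * c + b) := by
    have h2 : x - algebraMap R T (π ^ k * c + b) = algebraMap R T (π ^ k) *
        (y₀ + algebraMap R T π * w - algebraMap R T c) + (p - algebraMap R T b) := by
      rw [map_add, map_mul]
      linear_combination hxy
    rw [h2]
    refine dvd_add ?_ hb
    rw [pow_succ, map_mul]
    exact mul_dvd_mul_left _ hc
  have h3 := map_dvd (algebraMap R S)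
    (h.dvd_sub_of_dvd_sub (n := k + 1) (x := x) (a := a) ⟨w, hw⟩ h1)
  rw [← sub_add_cancel a (π ^ k * c + b), map_add]
  refine dvd_add h3 ?_
  rw [map_add, map_mul]
  refine dvd_add ?_ (h.dvd_of_mem_kernel hp hb)
  rw [pow_succ, map_mul]
  exact mul_dvd_mul_left _ (hdvd c hcm)

theorem hasSquareZeroPrimeWithDVRQuotient [IsLocalRing R] [IsDomain S] [FaithfulSMul R S]
    (h : IsPrincipalAdicCompletion R T π) (hq : IsQuadraticAlgebra R S)
    (hsum : ∀ s : S, ∃ (r : R) (t : S), s = algebraMap R S r + algebraMap R S π * t)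
    (hdim : ∀ x : R, x ≠ 0 → ∃ n, x ∣ π ^ n) (hπ0 : π ≠ 0)
    (hπ : π ∈ IsLocalRing.maximalIdeal R)
    (hden : ∀ s : S, ∃ d r : R, d ≠ 0 ∧ algebraMap R S d * s = algebraMap R S r)
    (hsurj : ¬ Function.Surjective (algebraMap R S)) (hπS : ¬ IsUnit (algebraMap R S π))
    (hdvd : ∀ r ∈ IsLocalRing.maximalIdeal R, algebraMap R S π ∣ algebraMap R S r) :
    HasSquareZeroPrimeWithDVRQuotient T := by
  let P := h.kernel S
  have hpow := h.pow_notMem_kernel hπ0 hπS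
  have hfac := fun x (hx : x ∉ P) ↦ h.exists_eq_pow_mul_add hsum hπ hdvd hx
  have hmk : ∀ {k : ℕ} {u p : T}, p ∈ P → Ideal.Quotient.mk P (algebraMap R T (π ^ k) * u + p) =
      Ideal.Quotient.mk P (algebraMap R T π) ^ k * Ideal.Quotient.mk P u := fun hp ↦ by
    rw [map_add, Ideal.Quotient.eq_zero_iff_mem.mpr hp, add_zero, map_mul, map_pow, map_pow]
  have hprime : P.IsPrime := by
    refine ⟨fun h1 ↦ hpow 0 ?_, fun {x y} hxy ↦ ?_⟩
    · change _ ∈ P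
      rw [h1]
      exact Submodule.mem_top
    by_contra! hcon
    obtain ⟨k, u, p, hu, hp, hx⟩ := hfac x hcon.1
    obtain ⟨l, v, q, hv, hq, hy⟩ := hfac y hcon.2
    apply hpow (k + l)
    rw [← Ideal.Quotient.eq_zero_iff_mem] at hxy ⊢
    rw [map_mul, hx, hy, hmk hp, hmk hq] at hxy
    have hu' := hu.map (Ideal.Quotient.mk P)
    have hv' := hv.map (Ideal.Quotient.mk P)
    rw [map_pow, map_pow, pow_add, ← hv'.mul_left_eq_zero, ← hu'.mul_left_eq_zero, ← hxy]
    ring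
  refine ⟨P, hprime, h.kernel_ne_bot hsum hdim hπ0 hden hsurj, h.kernel_sq hq, ?_⟩
  have hπne : Ideal.Quotient.mk P (algebraMap R T π) ≠ 0 := by
    have h1 := hpow 1
    rwa [pow_one, ← Ideal.Quotient.eq_zero_iff_mem] at h1
  have hπnu : ¬ IsUnit (Ideal.Quotient.mk P (algebraMap R T π)) := by
    intro hu
    obtain ⟨t, ht⟩ := hu.exists_right_inv
    obtain ⟨t, rfl⟩ := Ideal.Quotient.mk_surjective t
    rw [← map_mul, ← map_one (Ideal.Quotient.mk P), Ideal.Quotient.eq] at ht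
    have h1 := h.dvd_of_mem_kernel (n := 1) (a := -1) ht (by
      rw [map_neg, map_one, pow_one]
      exact ⟨t, by ring⟩)
    rw [pow_one, map_neg, map_one, dvd_neg] at h1
    exact hπS (isUnit_of_dvd_one h1)
  have hfac' : ∀ x : T ⧸ P, x ≠ 0 → ∃ (k : ℕ) (u : T ⧸ P), IsUnit u ∧
      x = Ideal.Quotient.mk P (algebraMap R T π) ^ k * u := by
    intro x hx
    obtain ⟨x, rfl⟩ := Ideal.Quotient.mk_surjective x
    obtain ⟨k, u, p, hu, hp, hxu⟩ := hfac x (by rwa [ne_eq, Ideal.Quotient.eq_zero_iff_mem] at hx)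
    exact ⟨k, _, hu.map _, by rw [hxu, hmk hp]⟩
  refine IsDiscreteValuationRing.ofHasUnitMulPowIrreducibleFactorization
    ⟨Ideal.Quotient.mk P (algebraMap R T π), ⟨hπnu, fun a b hab ↦ ?_⟩, fun {x} hx ↦ ?_⟩
  · have ha : a ≠ 0 := by
      rintro rfl
      exact hπne (by rw [hab, zero_mul])
    have hb : b ≠ 0 := by
      rintro rfl
      exact hπne (by rw [hab, mul_zero])
    obtain ⟨k, u, hu, rfl⟩ := hfac' a ha
    obtain ⟨l, v, hv, rfl⟩ := hfac' b hb
    rcases k with _ | k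
    · left
      simpa using hu
    rcases l with _ | l
    · right
      simpa using hv
    refine absurd (IsUnit.of_mul_eq_one
      (Ideal.Quotient.mk P (algebraMap R T π) ^ k * Ideal.Quotient.mk P (algebraMap R T π) ^ l *
        u * v) (mul_left_cancel₀ hπne ?_)) hπnu
    rw [mul_one]
    conv_rhs => rw [hab]
    ring
  · obtain ⟨k, u, hu, rfl⟩ := hfac' x hx
    exact ⟨k, (associated_mul_unit_right _ _ hu)⟩

end

end IsPrincipalAdicCompletion

/-! ### The completion in the ideal topology -/

section IdealTopology

variable {R : Type*} [CommRing R]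

noncomputable instance : Algebra R (idealTopologyCompletion R) :=
  ((RingHom.pi fun r : {r : R // r ≠ 0} ↦ Ideal.Quotient.mk (Ideal.span {(r : R)})).codRestrict
    (idealTopologyCompletion R) fun _ _ _ _ ↦ rfl).toAlgebra

theorem idealTopologyCompletion.val_eq_mk_of_dvd (x : idealTopologyCompletion R)
    {r s : {r : R // r ≠ 0}} (h : (r : R) ∣ (s : R)) {a : R}
    (ha : x.1 s = Ideal.Quotient.mk _ a) : x.1 r = Ideal.Quotient.mk _ a := by
  rw [← x.2 r s h, ha, Ideal.Quotient.factor_mk]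

theorem idealTopologyCompletion.algebraMap_dvd_of_val_eq_zero [IsDomain R]
    {y : idealTopologyCompletion R} {r : {r : R // r ≠ 0}} (hy : y.1 r = 0) :
    algebraMap R (idealTopologyCompletion R) r ∣ y := by
  -- The `s`-component of the quotient `y/r` is read off from the component of `y` at `r * s`, after
  -- cancelling `r`.
  let m : {r : R // r ≠ 0} → {r : R // r ≠ 0} := fun s ↦ ⟨r * s, mul_ne_zero r.2 s.2⟩
  choose b hb using fun s ↦ Ideal.Quotient.mk_surjective (y.1 (m s))
  have hrb : ∀ s, (r : R) ∣ b s := fun s ↦ by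
    have h1 := val_eq_mk_of_dvd y (r := r) (s := m s) (dvd_mul_right _ _) (hb s).symm
    rw [hy] at h1
    exact Ideal.mem_span_singleton.mp (Ideal.Quotient.eq_zero_iff_mem.mp h1.symm)
  choose c hc using hrb
  refine ⟨⟨fun s ↦ Ideal.Quotient.mk _ (c s), fun s s' h ↦ ?_⟩, ?_⟩
  · rw [Ideal.Quotient.factor_mk, Ideal.Quotient.eq, Ideal.mem_span_singleton]
    have h1 := val_eq_mk_of_dvd y (r := m s) (s := m s') (mul_dvd_mul_left _ h) (hb s').symm
    rw [← hb s, eq_comm, Ideal.Quotient.eq, Ideal.mem_span_singleton, hc, hc, ← mul_sub] at h1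
    exact (mul_dvd_mul_iff_left r.2).mp h1
  · ext s
    have h1 := val_eq_mk_of_dvd y (r := s) (s := m s) (dvd_mul_left _ _) (hb s).symm
    rw [h1, hc s]
    rfl

theorem isPrincipalAdicCompletion_idealTopologyCompletion [IsDomain R] {π : R} (hπ0 : π ≠ 0)
    (hπ : ¬ IsUnit π) (hdim : ∀ x : R, x ≠ 0 → ∃ n, x ∣ π ^ n) :
    IsPrincipalAdicCompletion R (idealTopologyCompletion R) π := by
  have hpow : ∀ n, π ^ n ≠ 0 := fun n ↦ pow_ne_zero n hπ0
  have hval : ∀ (n : ℕ) (y : idealTopologyCompletion R), y.1 ⟨π ^ n, hpow n⟩ = 0 →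
      algebraMap R (idealTopologyCompletion R) (π ^ n) ∣ y := fun n y hy ↦
    idealTopologyCompletion.algebraMap_dvd_of_val_eq_zero hy
  have hdvd : ∀ (n : ℕ) (y : idealTopologyCompletion R),
      algebraMap R (idealTopologyCompletion R) (π ^ n) ∣ y → y.1 ⟨π ^ n, hpow n⟩ = 0 := by
    rintro n _ ⟨t, rfl⟩
    change Ideal.Quotient.mk _ (π ^ n) * t.1 _ = 0
    rw [Ideal.Quotient.eq_zero_iff_mem.mpr (Ideal.mem_span_singleton_self _), zero_mul]
  have hsub : ∀ (x : idealTopologyCompletion R) (a : R) (n : ℕ),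
      x.1 ⟨π ^ n, hpow n⟩ = Ideal.Quotient.mk _ a →
      (x - algebraMap R (idealTopologyCompletion R) a).1 ⟨π ^ n, hpow n⟩ = 0 := fun x a n h ↦ by
    change x.1 _ - Ideal.Quotient.mk _ a = 0
    rw [h, sub_self]
  refine ⟨fun n x ↦ ?_, fun n a ha ↦ ?_, fun x hx ↦ ?_, fun f hf ↦ ?_⟩
  · obtain ⟨a, ha⟩ := Ideal.Quotient.mk_surjective (x.1 ⟨π ^ n, hpow n⟩)
    exact ⟨a, hval n _ (hsub x a n ha.symm)⟩
  · have h1 := hdvd n _ ha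
    exact Ideal.mem_span_singleton.mp (Ideal.Quotient.eq_zero_iff_mem.mp h1)
  · ext r
    obtain ⟨n, hn⟩ := hdim r r.2
    have h1 := idealTopologyCompletion.val_eq_mk_of_dvd x (r := r) (s := ⟨π ^ n, hpow n⟩) hn
      (a := 0) (by rw [hdvd n x (hx n), map_zero])
    rw [h1, map_zero]
    rfl
  · have hf' : ∀ n k, π ^ n ∣ f (n + k) - f n := by
      intro n k
      induction k with
      | zero => simp
      | succ k ih =>
        have h1 := dvd_add ((pow_dvd_pow π (Nat.le_add_right n k)).trans (hf (n + k))) ih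
        rwa [sub_add_sub_cancel] at h1
    have hf'' : ∀ n m, n ≤ m → π ^ n ∣ f m - f n := fun n m h ↦ by
      obtain ⟨k, rfl⟩ := Nat.exists_eq_add_of_le h
      exact hf' n k
    choose N hN using fun r : {r : R // r ≠ 0} ↦ hdim r r.2
    refine ⟨⟨fun r ↦ Ideal.Quotient.mk _ (f (N r)), fun r s h ↦ ?_⟩, fun n ↦ ?_⟩
    · rw [Ideal.Quotient.factor_mk, Ideal.Quotient.eq, Ideal.mem_span_singleton]
      rcases le_total (N r) (N s) with h1 | h1
      · exact (hN r).trans (hf'' _ _ h1)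
      · rw [dvd_sub_comm]
        exact (h.trans (hN s)).trans (hf'' _ _ h1)
    · refine hval n _ (hsub _ _ n ?_)
      rw [Ideal.Quotient.eq, Ideal.mem_span_singleton]
      exact hf'' _ _ ((pow_dvd_pow_iff hπ0 hπ).mp (hN ⟨π ^ n, hpow n⟩))

end IdealTopology

/-! ### The adic completion -/

section AdicCompletion

variable {R : Type*} [CommRing R] {I : Ideal R}

/-- For finitely generated `I`, the kernel of evaluation at level `k` is `I^k` times the completion.
-/
theorem AdicCompletion.algebraMap_dvd_of_evalₐ_eq_zero (hI : I.FG) {k : ℕ} {a : R}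
    (hk : I ^ k ≤ Ideal.span {a}) {y : AdicCompletion I R} (hy : evalₐ I k y = 0) :
    algebraMap R (AdicCompletion I R) a ∣ y := by
  have h1 : y ∈ (I ^ k • ⊤ : Submodule R (AdicCompletion I R)) := by
    rw [pow_smul_top_eq_ker_eval hI, LinearMap.mem_ker,
      ← factor_evalₐ_eq_eval _ y (by simp), hy, _root_.map_zero]
  rw [Ideal.smul_top_eq_map, Submodule.restrictScalars_mem] at h1
  have h2 := Ideal.map_mono (f := algebraMap R (AdicCompletion I R)) hk h1
  rwa [Ideal.map_span, Set.image_singleton, Ideal.mem_span_singleton] at h2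

theorem AdicCompletion.exists_sub_mul_mem_of_algebraMap_dvd {a b : R}
    (h : algebraMap R (AdicCompletion I R) a ∣ algebraMap R (AdicCompletion I R) b) (k : ℕ) :
    ∃ c, b - a * c ∈ I ^ k := by
  obtain ⟨t, ht⟩ := h
  obtain ⟨c, hc⟩ := Ideal.Quotient.mk_surjective (evalₐ I k t)
  refine ⟨c, ?_⟩
  have h1 := congrArg (evalₐ I k) ht
  rw [map_mul, AlgHom.commutes, AlgHom.commutes, ← hc] at h1
  rw [← Ideal.Quotient.eq, map_mul]
  exact h1

theorem isPrincipalAdicCompletion_adicCompletion (hI : I.FG) {π : R} (hπ : π ∈ I)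
    (hdim : ∀ n, ∃ k, I ^ k ≤ Ideal.span {π ^ n}) :
    IsPrincipalAdicCompletion R (AdicCompletion I R) π := by
  refine ⟨fun n x ↦ ?_, fun n a ha ↦ ?_, fun x hx ↦ ?_, fun f hf ↦ ?_⟩
  · obtain ⟨k, hk⟩ := hdim n
    obtain ⟨a, ha⟩ := Ideal.Quotient.mk_surjective (AdicCompletion.evalₐ I k x)
    refine ⟨a, AdicCompletion.algebraMap_dvd_of_evalₐ_eq_zero hI hk ?_⟩
    rw [map_sub, AlgHom.commutes, ← ha, Ideal.Quotient.algebraMap_eq, sub_self]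
  · obtain ⟨k, hk⟩ := hdim n
    obtain ⟨c, hc⟩ := AdicCompletion.exists_sub_mul_mem_of_algebraMap_dvd ha k
    have h1 := Ideal.mem_span_singleton.mp (hk hc)
    rw [← sub_add_cancel a (π ^ n * c)]
    exact dvd_add h1 (dvd_mul_right _ c)
  · refine AdicCompletion.ext_evalₐ fun n ↦ ?_
    obtain ⟨t, rfl⟩ := hx n
    rw [map_mul, AlgHom.commutes, Ideal.Quotient.algebraMap_eq,
      Ideal.Quotient.eq_zero_iff_mem.mpr (Ideal.pow_mem_pow hπ n), zero_mul, map_zero]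
  · have hf' : ∀ n k, π ^ n ∣ f (n + k) - f n := by
      intro n k
      induction k with
      | zero => simp
      | succ k ih =>
        have h1 := dvd_add ((pow_dvd_pow π (Nat.le_add_right n k)).trans (hf (n + k))) ih
        rwa [sub_add_sub_cancel] at h1
    let g : AdicCompletion.AdicCauchySequence I R := AdicCompletion.AdicCauchySequence.mk I R f
      fun n ↦ by
        rw [SModEq.sub_mem, ← neg_sub, neg_mem_iff, smul_eq_mul, Ideal.mul_top]
        exact Ideal.mem_of_dvd _ (hf n) (Ideal.pow_mem_pow hπ n)
    refine ⟨AdicCompletion.mk I R g, fun n ↦ ?_⟩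
    obtain ⟨k, hk⟩ := hdim n
    -- The limit agrees with `f j` modulo `I^j`, and it takes `I^k` to reach `π^n`; the index `n +
    -- k` ensures this and still gives `f (n + k) ≡ f n` modulo `π^n`.
    have h1 : algebraMap R (AdicCompletion I R) (π ^ n) ∣
        AdicCompletion.mk I R g - algebraMap R _ (f (n + k)) := by
      refine AdicCompletion.algebraMap_dvd_of_evalₐ_eq_zero hI
        ((Ideal.pow_le_pow_right (Nat.le_add_left k n)).trans hk) ?_
      rw [map_sub, AlgHom.commutes, AdicCompletion.evalₐ_mk, Ideal.Quotient.algebraMap_eq]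
      exact sub_self _
    have h2 := dvd_add h1 (map_dvd (algebraMap R (AdicCompletion I R)) (hf' n k))
    rwa [map_sub, sub_add_sub_cancel] at h2

end AdicCompletion

/-! ### From bad stability to the prime `P` -/

theorem IsBadStableDomain.hasSquareZeroPrimeWithDVRQuotient {R T : Type*} [CommRing R]
    [CommRing T] [Algebra R T] [IsDomain R] [IsLocalRing R] (hR : IsBadStableDomain R)
    (hT : ∀ π ∈ IsLocalRing.maximalIdeal R, π ≠ 0 → IsPrincipalAdicCompletion R T π) :
    HasSquareZeroPrimeWithDVRQuotient T := by
  let F := FractionRing R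
  let S := integralClosure R F
  have hsq := hR.stable.hasPrincipalSquare
  have hq : IsQuadraticAlgebra R S := fun s t ↦ by
    obtain ⟨α, β, γ, h⟩ := IsIntegral.exists_mul_eq_of_hasPrincipalSquare hsq s.2 t.2
    exact ⟨α, β, γ, Subtype.ext h⟩
  have hden : ∀ s : S, ∃ d r : R, d ≠ 0 ∧ algebraMap R S d * s = algebraMap R S r := fun s ↦ by
    obtain ⟨d, a, -, hd, h, -⟩ := exists_common_denominator (R := R) (s : F) (s : F)
    exact ⟨d, a, hd, Subtype.ext h⟩
  have hnf : ¬ Module.Finite R S := hR.not_finite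
  obtain ⟨π, hπ, hπ0, hsum, hdvd⟩ := exists_uniformizer hR.krullDim_eq_one hsq hq
    (IsIntegral.exists_gcd_of_hasPrincipalSquare hsq) hden hnf
  have hunit : ∀ r ∈ IsLocalRing.maximalIdeal R, ¬ IsUnit (algebraMap R S r) := fun r hr hu ↦ by
    obtain ⟨N, hN⟩ := Ideal.exists_maximal S
    exact hN.ne_top (N.eq_top_of_isUnit_mem
      ((algebraMap_mem_iff_mem_maximalIdeal hN).mpr hr) hu)
  exact (hT π hπ hπ0).hasSquareZeroPrimeWithDVRQuotient hq hsum
    (fun x hx ↦ exists_dvd_pow_of_ringKrullDim_eq_one hR.krullDim_eq_one hx hπ) hπ0 hπ hden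
    (fun hsurj ↦ hnf (Module.Finite.of_surjective (Algebra.linearMap R S) hsurj))
    (hunit π hπ) fun r hr ↦ hdvd _ (hunit r hr)

theorem IsLocalRing.exists_mem_ne_zero_of_ringKrullDim_eq_one {R : Type*} [CommRing R]
    [IsDomain R] [IsLocalRing R] (hR : ringKrullDim R = 1) :
    ∃ π ∈ IsLocalRing.maximalIdeal R, π ≠ 0 :=
  Submodule.exists_mem_ne_zero_of_ne_bot fun h ↦
    (ringKrullDim_eq_one_iff_of_isLocalRing_isDomain.mp hR).1
      (IsLocalRing.isField_iff_maximalIdeal_eq.mpr h)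

theorem isPrincipalAdicCompletion_maximalIdeal {R : Type*} [CommRing R] [IsDomain R]
    [IsLocalRing R] [IsNoetherianRing R] (hR : ringKrullDim R = 1) {π : R}
    (hπ : π ∈ IsLocalRing.maximalIdeal R) (hπ0 : π ≠ 0) :
    IsPrincipalAdicCompletion R (AdicCompletion (IsLocalRing.maximalIdeal R) R) π := by
  have hfg := (IsLocalRing.maximalIdeal R).fg_of_isNoetherianRing
  exact isPrincipalAdicCompletion_adicCompletion hfg hπ fun n ↦
    Ideal.exists_pow_le_of_le_radical_of_fg
      ((ringKrullDim_eq_one_iff_of_isLocalRing_isDomain.mp hR).2 _ (pow_ne_zero n hπ0)) hfg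

/-! ### Dimension one from the completion of a Noetherian local domain -/

section NoetherianLocal

open IsLocalRing

variable {R : Type*} [CommRing R] [IsLocalRing R] [IsNoetherianRing R]

/-- Krull's intersection theorem for `R/rR`: principal ideals are closed. -/
theorem AdicCompletion.dvd_of_algebraMap_dvd {r x : R}
    (h : algebraMap R (AdicCompletion (maximalIdeal R) R) r ∣
      algebraMap R (AdicCompletion (maximalIdeal R) R) x) : r ∣ x := by
  rw [← Ideal.mem_span_singleton, ← Ideal.Quotient.eq_zero_iff_mem]
  refine IsHausdorff.haus (I := maximalIdeal R) inferInstance _ fun n ↦ ?_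
  obtain ⟨c, hc⟩ := AdicCompletion.exists_sub_mul_mem_of_algebraMap_dvd h n
  rw [SModEq.zero]
  have h1 : Ideal.Quotient.mk (Ideal.span {r}) x =
      (x - r * c) • (1 : R ⧸ Ideal.span {r}) := by
    rw [Algebra.smul_def, mul_one, Ideal.Quotient.algebraMap_eq, Ideal.Quotient.eq,
      Ideal.mem_span_singleton]
    exact ⟨c, by ring⟩
  rw [h1]
  exact Submodule.smul_mem_smul hc Submodule.mem_top

theorem AdicCompletion.exists_pow_le_span_of_hasSquareZeroPrime [IsDomain R]
    {P : Ideal (AdicCompletion (maximalIdeal R) R)} [hprime : P.IsPrime] (hP : P ^ 2 = ⊥)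
    [IsDiscreteValuationRing (AdicCompletion (maximalIdeal R) R ⧸ P)] {r : R} (hr : r ≠ 0) :
    ∃ n, maximalIdeal R ^ n ≤ Ideal.span {r} := by
  let T := AdicCompletion (maximalIdeal R) R
  have hinj : Function.Injective (algebraMap R T) := AdicCompletion.of_injective _ R
  let φ : R →+* T ⧸ P := (Ideal.Quotient.mk P).comp (algebraMap R T)
  have hφr : φ r ≠ 0 := by
    intro h
    have h1 : algebraMap R T r ∈ P := Ideal.Quotient.eq_zero_iff_mem.mp h
    have h2 : algebraMap R T (r * r) = 0 := by
      rw [← Ideal.mem_bot, ← hP, sq, map_mul]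
      exact Ideal.mul_mem_mul h1 h1
    exact mul_ne_zero hr hr ((map_eq_zero_iff _ hinj).mp h2)
  have hloc : (maximalIdeal R).map φ ≤ maximalIdeal (T ⧸ P) := by
    rw [Ideal.map_le_iff_le_comap]
    intro x hx
    rw [Ideal.mem_comap, mem_maximalIdeal, mem_nonunits_iff]
    intro hu
    obtain ⟨t, ht⟩ := hu.exists_right_inv
    obtain ⟨t, rfl⟩ := Ideal.Quotient.mk_surjective t
    have h1 : algebraMap R T x * t - 1 ∈ P := by
      rw [← Ideal.Quotient.eq, map_mul, map_one]
      exact ht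
    have h2 := le_maximalIdeal hprime.ne_top h1
    have h3 : algebraMap R T x ∈ maximalIdeal T := by
      rw [maximalIdeal_eq_map]
      exact Ideal.mem_map_of_mem _ hx
    have h4 := sub_mem (Ideal.mul_mem_right t _ h3) h2
    rw [sub_sub_cancel] at h4
    exact (Ideal.ne_top_iff_one _).mp (maximalIdeal.isMaximal T).ne_top h4
  obtain ⟨k, hk⟩ := Ideal.exists_pow_le_of_le_radical_of_fg
    (I := maximalIdeal (T ⧸ P)) (J := Ideal.span {φ r})
    (fun w hw ↦ by
      obtain ⟨n, hn⟩ := exists_dvd_pow_of_dimensionLEOne hφr hw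
      exact ⟨n, Ideal.mem_span_singleton.mpr hn⟩)
    (Ideal.fg_of_isNoetherianRing _)
  have hlift : ∀ x ∈ maximalIdeal R ^ k, ∃ t : T, algebraMap R T x - algebraMap R T r * t ∈ P := by
    intro x hx
    have h1 : φ x ∈ Ideal.span {φ r} := by
      refine hk (Ideal.pow_right_mono hloc k ?_)
      rw [← Ideal.map_pow]
      exact Ideal.mem_map_of_mem _ hx
    obtain ⟨t, ht⟩ := Ideal.mem_span_singleton.mp h1
    obtain ⟨t, rfl⟩ := Ideal.Quotient.mk_surjective t
    refine ⟨t, ?_⟩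
    rw [← Ideal.Quotient.eq, map_mul]
    exact ht
  -- For `x, y ∈ m^k` there are `s, t` with `x - rs, y - rt ∈ P`. Expanding their zero product puts
  -- `xy` in `rT ∩ R = rR`, so twice the exponent suffices.
  refine ⟨k + k, ?_⟩
  rw [pow_add, Ideal.mul_le]
  intro x hx y hy
  obtain ⟨s, hs⟩ := hlift x hx
  obtain ⟨t, ht⟩ := hlift y hy
  have h0 : (algebraMap R T x - algebraMap R T r * s) * (algebraMap R T y - algebraMap R T r * t) =
      0 := by
    rw [← Ideal.mem_bot, ← hP, sq]
    exact Ideal.mul_mem_mul hs ht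
  refine Ideal.mem_span_singleton.mpr (AdicCompletion.dvd_of_algebraMap_dvd
    ⟨s * algebraMap R T y + t * algebraMap R T x - algebraMap R T r * s * t, ?_⟩)
  rw [map_mul]
  linear_combination h0

theorem AdicCompletion.ringKrullDim_eq_one_of_hasSquareZeroPrime [IsDomain R]
    (h : HasSquareZeroPrimeWithDVRQuotient (AdicCompletion (maximalIdeal R) R)) :
    ringKrullDim R = 1 := by
  obtain ⟨P, hprime, hP0, hP, hV⟩ := h
  rw [ringKrullDim_eq_one_iff_of_isLocalRing_isDomain]
  refine ⟨fun hfield ↦ hP0 ?_, fun r hr w hw ↦ ?_⟩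
  -- If `R` were a field, the maximal ideal `mT` of the completion would vanish, and `P` with it.
  · have h1 := le_maximalIdeal hprime.ne_top
    have h2 : (maximalIdeal R).map (algebraMap R (AdicCompletion (maximalIdeal R) R)) = ⊥ := by
      rw [Ideal.map_eq_bot_iff_le_ker, isField_iff_maximalIdeal_eq.mp hfield]
      exact bot_le
    rw [maximalIdeal_eq_map, h2] at h1
    exact le_bot_iff.mp h1
  · obtain ⟨n, hn⟩ := AdicCompletion.exists_pow_le_span_of_hasSquareZeroPrime hP hr
    exact ⟨n, hn (Ideal.pow_mem_pow hw n)⟩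

end NoetherianLocal

theorem theorem3p4 :
    (∀ (R : Type u) [CommRing R] [IsDomain R] [IsLocalRing R], ringKrullDim R = 1 →
      (IsBadStableDomain R ↔
        HasSquareZeroPrimeWithDVRQuotient (idealTopologyCompletion R))) ∧
    (∀ (R : Type u) [CommRing R] [IsDomain R] [IsLocalRing R] [IsNoetherianRing R],
      (IsBadStableDomain R ↔
        HasSquareZeroPrimeWithDVRQuotient
          (AdicCompletion (IsLocalRing.maximalIdeal R) R))) := by
  refine ⟨fun R _ _ _ hR ↦ ?_, fun R _ _ _ _ ↦ ⟨fun h ↦ ?_, fun h ↦ ?_⟩⟩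
  · have hT : ∀ π ∈ IsLocalRing.maximalIdeal R, π ≠ 0 →
        IsPrincipalAdicCompletion R (idealTopologyCompletion R) π := fun π hπ hπ0 ↦
      isPrincipalAdicCompletion_idealTopologyCompletion hπ0 hπ fun x hx ↦
        exists_dvd_pow_of_ringKrullDim_eq_one hR hx hπ
    obtain ⟨π, hπ, hπ0⟩ := IsLocalRing.exists_mem_ne_zero_of_ringKrullDim_eq_one hR
    exact ⟨fun h ↦ h.hasSquareZeroPrimeWithDVRQuotient hT,
      (hT π hπ hπ0).isBadStableDomain hR hπ hπ0⟩
  · exact h.hasSquareZeroPrimeWithDVRQuotient fun π hπ hπ0 ↦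
      isPrincipalAdicCompletion_maximalIdeal h.krullDim_eq_one hπ hπ0
  · have hR := AdicCompletion.ringKrullDim_eq_one_of_hasSquareZeroPrime h
    obtain ⟨π, hπ, hπ0⟩ := IsLocalRing.exists_mem_ne_zero_of_ringKrullDim_eq_one hR
    exact (isPrincipalAdicCompletion_maximalIdeal hR hπ hπ0).isBadStableDomain hR hπ hπ0 h
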